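/- Let $\lambda>0$, $p_A\in(0,1)$, $p_B=1-p_A$, $q\in[0,1]$, $\alpha>2$ and $T>0$. Devices form a homogeneous Poisson point process $\Phi$ of intensity $\lambda$ in $\mathbb{R}^2$. Each device $x\in\Phi$ carries independent marks, which are also independent of the locations and of the marks of the other devices: a cached file portion (A with probability $p_A$, B with probability $p_B$), a fading $h_x\sim\exp(1)$, and an activity indicator $t_x\in\{0,1\}$ with $\mathbb{P}(t_x=1)=q$. A user at the origin that is served by $x\in\Phi$ has $$\mathtt{SIR}(x)=\frac{h_x\|x\|^{-\alpha}}{\sum_{y\in\Phi\setminus\{x\}}t_yh_y\|y\|^{-\alpha}}$$ (equal to $\infty$ if nobody interferes). For $v\ge 0$, call the file portion cached by the device closest to $(-v,0)$ file 1 and the other portion file 2. Let $x_2$ be the device closest to the origin among those that cache file 2, and let $P_{c_2}(v)=\mathbb{P}(\mathtt{SIR}(x_2)>T)$ be the coverage probability of file 2. Then $$\lim_{v\to\infty}P_{c_2}(v)=p_A\,\mathtt{P_c}(p_B)+p_B\,\mathtt{P_c}(p_A),\qquad \mathtt{P_c}(p)=\frac{p}{p+q\,[\rho_1(T,\alpha)+(1-p)\rho_2(T,\alpha)]},$$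 where $$\rho_1(T,\alpha)=T^{2/\alpha}\int_{T^{-2/\alpha}}^{\infty}\frac{du}{1+u^{\alpha/2}},\qquad \rho_2(T,\alpha)=T^{2/\alpha}\int_0^{T^{-2/\alpha}}\frac{du}{1+u^{\alpha/2}}.$$ This limit is the independent scenario: for $f\in\{A,B\}$, $\mathtt{P_c}(p_f)$ is exactly the coverage probability $\mathbb{P}(\mathtt{SIR}(x_f)>T)$ at the origin, where $x_f$ is the device closest to the origin among all those that cache portion $f$ (so nothing about another location enters). -/

import Mathlib

open MeasureTheory ProbabilityTheory Filter Topology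
open scoped ENNReal NNReal

namespace D2DCaching

/-- The plane with its Euclidean distance and Lebesgue measure. -/
abbrev Plane : Type := EuclideanSpace ℝ (Fin 2)

/-- The two portions of the requested file. -/
inductive FilePortion : Type
  | A
  | B

instance instMeasurableSpaceFilePortion : MeasurableSpace FilePortion := ⊤

instance instDiscreteMeasurableSpaceFilePortion : DiscreteMeasurableSpace FilePortion :=
  ⟨fun _ => trivial⟩

/-- A random measure `ξ` is a Poisson point process with intensity measure `ν`: the number of points
in a set of finite intensity is Poisson distributed, and the numbers of points in pairwise disjoint
sets are independent. -/
structure IsPoissonProcess {E Ω : Type*} [MeasurableSpace E] [MeasurableSpace Ω]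
    (ν : Measure E) (ξ : Ω → Measure E) (μ : Measure Ω) : Prop where
  hasLaw : ∀ s : Set E, MeasurableSet s → ν s ≠ ∞ →
    HasLaw (fun ω => ξ ω s) ((poissonMeasure (ν s).toNNReal).map (fun k : ℕ => (k : ℝ≥0∞))) μ
  indep : ∀ (k : ℕ) (s : Fin k → Set E), (∀ i, MeasurableSet (s i)) →
    Pairwise (fun i j => Disjoint (s i) (s j)) → iIndepFun (fun i ω => ξ ω (s i)) μ

/-- The network: `X n` is the location of the `n`-th device, `file n` the portion it caches,
`fading n` the power of its fading channel to the origin, and `active n` says whether it transmits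
when it is an interferer. The devices form a homogeneous Poisson point process of intensity `lam`
in the plane. Their marks are independent of the locations and of each other, with the product of
the laws `P(file = A) = p`, `fading ∼ Exp(1)`, and `P(active) = q`. -/
structure IsNetwork {Ω : Type*} [MeasurableSpace Ω] (μ : Measure Ω) (lam : ℝ)
    (p q : unitInterval) (X : ℕ → Ω → Plane) (file : ℕ → Ω → FilePortion)
    (fading : ℕ → Ω → ℝ) (active : ℕ → Ω → Bool) : Prop where
  measurable_location : ∀ n, Measurable (X n)
  measurable_file : ∀ n, Measurable (file n)
  measurable_fading : ∀ n, Measurable (fading n)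
  measurable_active : ∀ n, Measurable (active n)
  poisson : IsPoissonProcess (ENNReal.ofReal lam • (volume : Measure Plane))
    (fun ω => Measure.sum fun n => Measure.dirac (X n ω)) μ
  mark_law : ∀ n, HasLaw (fun ω => (file n ω, fading n ω, active n ω))
    ((bernoulliMeasure FilePortion.A FilePortion.B p).prod
      ((expMeasure 1).prod (bernoulliMeasure true false q))) μ
  mark_indep : iIndepFun (fun n ω => (file n ω, fading n ω, active n ω)) μ
  location_indep_mark : IndepFun (fun ω n => X n ω)
    (fun ω n => (file n ω, fading n ω, active n ω)) μ

/-- Among the points `x n` with `n ∈ S`, the point `x i` is closest to `z`. -/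
def IsClosest (x : ℕ → Plane) (S : Set ℕ) (z : Plane) (i : ℕ) : Prop :=
  i ∈ S ∧ ∀ m ∈ S, dist (x i) z ≤ dist (x m) z

/-- The power (for unit transmit power) received at the origin from a device at `x` with
fading `h` and path-loss exponent `α`. -/
noncomputable def power (α : ℝ) (x : Plane) (h : ℝ) : ℝ≥0∞ :=
  ENNReal.ofReal h * ‖x‖ₑ ^ (-α)

/-- The signal-to-interference ratio at the origin when device `j` serves and the other active
devices interfere (it is `∞` if the signal is positive and nobody interferes). -/
noncomputable def SIR (α : ℝ) (x : ℕ → Plane) (h : ℕ → ℝ) (t : ℕ → Bool) (j : ℕ) : ℝ≥0∞ :=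
  power α (x j) (h j) / ∑' m, if m ≠ j ∧ t m = true then power α (x m) (h m) else 0

/-- Location 1, at distance `v` from location 2, which is the origin. -/
noncomputable def location1 (v : ℝ) : Plane := !₂[-v, 0]

section Coverage

variable {Ω : Type*} [MeasurableSpace Ω] (μ : Measure Ω) (X : ℕ → Ω → Plane)
  (file : ℕ → Ω → FilePortion) (fading : ℕ → Ω → ℝ) (active : ℕ → Ω → Bool) (α T : ℝ)

/-- The coverage probability of file 2: device `i` is the one closest to location 1 (its portion is
file 1), device `j` is the one closest to the origin among those that cache the other portion
(file 2), and the SIR at the origin with serving device `j` exceeds `T`. -/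
noncomputable def coverageFile2 (v : ℝ) : ℝ :=
  μ.real {ω | ∃ i j, IsClosest (fun n => X n ω) Set.univ (location1 v) i ∧
    IsClosest (fun n => X n ω) {n | file n ω ≠ file i ω} 0 j ∧
    ENNReal.ofReal T < SIR α (fun n => X n ω) (fun n => fading n ω) (fun n => active n ω) j}

/-- The coverage probability of the portion `f` in the independent scenario: a user at the
origin is served by the closest device that caches `f`, with no reference to location 1. -/
noncomputable def coverageIndep (f : FilePortion) : ℝ :=
  μ.real {ω | ∃ j, IsClosest (fun n => X n ω) {n | file n ω = f} 0 j ∧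
    ENNReal.ofReal T < SIR α (fun n => X n ω) (fun n => fading n ω) (fun n => active n ω) j}

end Coverage

noncomputable def rho1 (T α : ℝ) : ℝ :=
  T ^ (2 / α) * ∫ u in Set.Ioi (T ^ (-(2 / α))), 1 / (1 + u ^ (α / 2))

noncomputable def rho2 (T α : ℝ) : ℝ :=
  T ^ (2 / α) * ∫ u in (0 : ℝ)..(T ^ (-(2 / α))), 1 / (1 + u ^ (α / 2))

noncomputable def Pc (T α q p : ℝ) : ℝ :=
  p / (p + q * (rho1 T α + (1 - p) * rho2 T α))

end D2DCaching

/-! Coverage at the origin. Fix the locations. Because fading is exponential, the event that device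
`j` serves portion `f` and covers the origin has, given all other marks, probability p_f exp(-s);
here s is T‖x_j‖^α times the interference, or ∞ if a closer device caches `f`. Averaging over the
independent marks gives p_f times a product over the other devices of a factor that depends only on
the two squared distances r and y (`marksLaw_covered`). Since a disc of squared radius b has area
πb, squared distances form a Poisson process of rate c = λπ on the half-line
(`isPoissonProcess_dist_sq`). The integral of one minus the factor is linear in r, namely c r K with
K = p_f + q(ρ₁ + (1 - p_f)ρ₂) (`lintegral_palmExponent`). A Campbell–Mecke computation then turns
the sum over `j` into ∫ c exp(-c r K) dr = 1/K (`lintegral_tsum_palmProd`), and the coverage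
probability is p_f / K.

The limit. No decorrelation of distant regions is needed. Let `i` be the device closest to location
1, and let g ≠ f. If `i` caches g, striking it from the candidates for `f`, while it goes on
interfering, changes nothing. Coverage with `i` struck out does not look at the portion of `i`, so
for every v the probability that `i` caches g and `f` is covered is exactly p_g times the
probability of coverage with `i` struck out (`IsNetwork.measure_closest_covered`). Almost surely
some device lies further left than the closest one that caches `f`, so for large v the latter is not
`i`, and striking `i` out again changes nothing (`IsNetwork.tendsto_measure_coveredExcept`). Each of
the two cases thus tends to p_g times the independent coverage probability of `f`. -/

namespace D2DCaching

/-! ### The exponential exp(-x) on [0, ∞] -/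

/-- The function `x ↦ exp (-x)` on the extended half-line, with `exp (-∞) = 0`. -/
noncomputable def negExp (x : ℝ≥0∞) : ℝ≥0∞ := EReal.exp (-(x : EReal))

@[simp] lemma negExp_zero : negExp 0 = 1 := by simp [negExp]

@[simp] lemma negExp_top : negExp ∞ = 0 := by simp [negExp]

lemma negExp_antitone : Antitone negExp := fun x y h => by
  simpa [negExp] using h

lemma negExp_le_one (x : ℝ≥0∞) : negExp x ≤ 1 := by
  simpa using negExp_antitone (zero_le (a := x))

lemma negExp_ne_top (x : ℝ≥0∞) : negExp x ≠ ∞ :=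
  ((negExp_le_one x).trans_lt ENNReal.one_lt_top).ne

lemma negExp_add (x y : ℝ≥0∞) : negExp (x + y) = negExp x * negExp y := by
  rw [negExp, negExp, negExp, ← EReal.exp_add, EReal.coe_ennreal_add, EReal.neg_add, sub_eq_add_neg]
  · left; simp
  · right; simp

lemma negExp_sum {ι : Type*} (s : Finset ι) (f : ι → ℝ≥0∞) :
    negExp (∑ i ∈ s, f i) = ∏ i ∈ s, negExp (f i) := by
  classical
  induction s using Finset.induction_on with
  | empty => simp
  | insert a s ha ih => rw [Finset.sum_insert ha, Finset.prod_insert ha, negExp_add, ih]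

lemma continuous_negExp : Continuous negExp :=
  ENNReal.continuous_exp.comp (continuous_neg.comp continuous_coe_ennreal_ereal)

lemma measurable_negExp : Measurable negExp := continuous_negExp.measurable

lemma negExp_ofReal {t : ℝ} (ht : 0 ≤ t) :
    negExp (ENNReal.ofReal t) = ENNReal.ofReal (Real.exp (-t)) := by
  rw [negExp, EReal.coe_ennreal_ofReal, max_eq_left ht, ← EReal.coe_neg, EReal.exp_coe]

/-- Every factor in [0, 1], zero included, has an exponent in [0, ∞]; infinite products of such
factors become sums, which always converge. -/
lemma exists_negExp_eq {g : ℝ≥0∞} (hg : g ≤ 1) : negExp ((-(ENNReal.log g)).toENNReal) = g := by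
  rw [negExp, EReal.coe_toENNReal, neg_neg, ENNReal.exp_log]
  rw [← EReal.neg_le_neg_iff]
  simpa using hg

lemma negExp_mul_natCast (c : ℝ≥0∞) (n : ℕ) : negExp (c * n) = negExp c ^ n := by
  induction n with
  | zero => simp
  | succ n ih => rw [Nat.cast_succ, mul_add, mul_one, negExp_add, ih, pow_succ]

lemma negExp_tsum_tendsto {f : ℕ → ℝ≥0∞} :
    Tendsto (fun n => ∏ i ∈ Finset.range n, negExp (f i)) atTop (𝓝 (negExp (∑' i, f i))) := by
  simp_rw [← negExp_sum]
  exact (continuous_negExp.tendsto _).comp ENNReal.summable.hasSum.tendsto_sum_nat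

/-- The Laplace transform of the Poisson distribution. -/
lemma lintegral_negExp_poisson (r : ℝ≥0) (c : ℝ≥0∞) :
    ∫⁻ k, negExp (c * k) ∂((poissonMeasure r).map (fun k : ℕ => (k : ℝ≥0∞))) =
      negExp ((1 - negExp c) * r) := by
  obtain ⟨t, ht⟩ : ∃ t : ℝ≥0, negExp c = t := ⟨_, (ENNReal.coe_toNNReal (negExp_ne_top c)).symm⟩
  have ht1 : t ≤ 1 := by exact_mod_cast ht ▸ negExp_le_one c
  rw [lintegral_map (f := fun k => negExp (c * k))
    (measurable_negExp.comp (measurable_const.mul measurable_id)) .of_discrete,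
    poissonMeasure, lintegral_sum_measure]
  simp_rw [lintegral_smul_measure, lintegral_dirac, negExp_mul_natCast, ht, smul_eq_mul]
  have h1 : ((1 : ℝ≥0∞) - t) * r = ENNReal.ofReal ((1 - t) * r) := by
    rw [ENNReal.ofReal_mul (by simpa using ht1), ENNReal.ofReal_sub _ (by simp)]
    simp
  rw [h1, negExp_ofReal (mul_nonneg (by simpa using ht1) r.coe_nonneg)]
  have h2 : ∀ n : ℕ, ENNReal.ofReal (Real.exp (-r) * r ^ n / n.factorial) * (t : ℝ≥0∞) ^ n =
      ENNReal.ofReal (Real.exp (-r) * ((t * r : ℝ) ^ n / n.factorial)) := by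
    intro n
    rw [← ENNReal.ofReal_coe_nnreal, ← ENNReal.ofReal_pow t.coe_nonneg, ← ENNReal.ofReal_mul (by positivity)]
    congr 1; rw [mul_pow]; ring
  simp_rw [h2]
  have h3 := (NormedSpace.expSeries_div_hasSum_exp ((t : ℝ) * r)).mul_left (Real.exp (-r))
  rw [← ENNReal.ofReal_tsum_of_nonneg (fun n => by positivity) h3.summable, h3.tsum_eq,
    ← Real.exp_eq_exp_ℝ, ← Real.exp_add]
  congr 2; ring


/-! ### Laplace functional of a Poisson process -/

section Laplace

variable {E Ω : Type*} [MeasurableSpace E] [MeasurableSpace Ω] {ν : Measure E}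
  {ξ : Ω → Measure E} {μ : Measure Ω}

lemma IsPoissonProcess.iIndepFun_of_fintype (h : IsPoissonProcess ν ξ μ) {ι : Type*} [Fintype ι]
    {s : ι → Set E} (hs : ∀ i, MeasurableSet (s i))
    (hd : Pairwise (fun i j => Disjoint (s i) (s j))) : iIndepFun (fun i ω => ξ ω (s i)) μ := by
  let e := (Fintype.equivFin ι).symm
  exact iIndepFun.of_precomp (g := e) e.surjective
    (h.indep _ (fun k => s (e k)) (fun k => hs _) (fun i j hij => hd (e.injective.ne hij)))

lemma IsPoissonProcess.lintegral_negExp_mul (h : IsPoissonProcess ν ξ μ) {s : Set E}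
    (hs : MeasurableSet s) (hν : ν s ≠ ∞) (c : ℝ≥0∞) :
    ∫⁻ ω, negExp (c * ξ ω s) ∂μ = negExp ((1 - negExp c) * ν s) := by
  have hm : Measurable fun k => negExp (c * k) :=
    measurable_negExp.comp (measurable_const.mul measurable_id)
  rw [← lintegral_map' (f := fun k => negExp (c * k)) hm.aemeasurable
    (h.hasLaw s hs hν).aemeasurable, (h.hasLaw s hs hν).map_eq, lintegral_negExp_poisson,
    ENNReal.coe_toNNReal hν]

/-- The nonzero level sets of `f` are disjoint from each other and from `A`, so their counts and the
count in `A` are independent, and the expectation splits into Poisson Laplace transforms. -/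
lemma IsPoissonProcess.laplace_simpleFunc (h : IsPoissonProcess ν ξ μ) (hξ : Measurable ξ)
    {A : Set E} (hA : MeasurableSet A) {φ : ℝ≥0∞ → ℝ≥0∞} (hφ : Measurable φ)
    (f : SimpleFunc E ℝ≥0∞) (hfA : ∀ x ∈ A, f x = 0)
    (hf : ∀ c, c ≠ 0 → ν (f ⁻¹' {c}) ≠ ∞) :
    ∫⁻ ω, φ (ξ ω A) * negExp (∫⁻ x, f x ∂(ξ ω)) ∂μ =
      (∫⁻ ω, φ (ξ ω A) ∂μ) * negExp (∫⁻ x, (1 - negExp (f x)) ∂ν) := by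
  classical
  let S := f.range.filter (· ≠ 0)
  -- The index `none` carries `A` with the factor `φ`; `some c` carries the level set of `c`.
  let s : Option S → Set E := fun o => o.elim A (fun c => f ⁻¹' {c.1})
  let Z : Option S → ℝ≥0∞ → ℝ≥0∞ := fun o => o.elim φ (fun c k => negExp (c.1 * k))
  have hs : ∀ o, MeasurableSet (s o) := by
    rintro (_ | c)
    · exact hA
    · exact f.measurableSet_fiber _
  have hS : ∀ c : S, (c : ℝ≥0∞) ≠ 0 := fun c => (Finset.mem_filter.1 c.2).2
  have hd : Pairwise (fun i j => Disjoint (s i) (s j)) := by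
    rintro (_ | c) (_ | d) hne
    · exact absurd rfl hne
    · exact Set.disjoint_left.2 fun x hx hx' => hS d
        ((show f x = d from hx').symm.trans (hfA x hx))
    · exact Set.disjoint_left.2 fun x hx hx' => hS c
        ((show f x = c from hx).symm.trans (hfA x hx'))
    · refine Set.disjoint_left.2 fun x hx hx' => hne ?_
      congr 1
      exact Subtype.ext ((show f x = c from hx).symm.trans hx')
  have hZ : ∀ o, Measurable (Z o) := by
    rintro (_ | c)
    · exact hφ
    · exact measurable_negExp.comp (measurable_const.mul measurable_id)
  have hind := (h.iIndepFun_of_fintype hs hd).comp Z hZ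
  have key := lintegral_prod_eq_prod_lintegral_of_indepFun Finset.univ _ hind
    (fun o => (hZ o).comp ((Measure.measurable_coe (hs o)).comp hξ))
  have hint : ∀ (m : Measure E) (g : ℝ≥0∞ → ℝ≥0∞), g 0 = 0 →
      ∫⁻ x, g (f x) ∂m = ∑ c : S, g c.1 * m (f ⁻¹' {c.1}) := fun m g hg => by
    rw [Finset.sum_coe_sort S (fun c => g c * m (f ⁻¹' {c})), Finset.sum_filter_of_ne,
      ← SimpleFunc.map_lintegral]
    · exact (SimpleFunc.lintegral_eq_lintegral (f.map g) m)
    · intro c _ hc h0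
      simp [h0, hg] at hc
  have h1 : ∀ ω, φ (ξ ω A) * negExp (∫⁻ x, f x ∂(ξ ω)) =
      ∏ i, (Z i ∘ fun ω => ξ ω (s i)) ω := fun ω => by
    rw [Fintype.prod_option, hint _ (fun c => c) rfl, negExp_sum]
    rfl
  simp_rw [h1]
  rw [key, Fintype.prod_option, hint ν (fun c => 1 - negExp c) (by simp), negExp_sum]
  congr 1
  exact Finset.prod_congr rfl fun c _ =>
    h.lintegral_negExp_mul (f.measurableSet_fiber _) (hf _ (hS c)) _

/-- The Laplace functional of a Poisson process, with an independent factor given by the number of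
points in a set off which the test function is supported. -/
lemma IsPoissonProcess.laplace [SigmaFinite ν] [IsProbabilityMeasure μ]
    (h : IsPoissonProcess ν ξ μ) (hξ : Measurable ξ)
    {A : Set E} (hA : MeasurableSet A) {φ : ℝ≥0∞ → ℝ≥0∞} (hφ : Measurable φ) (hφ1 : ∀ k, φ k ≤ 1)
    {f : E → ℝ≥0∞} (hf : Measurable f) (hfA : ∀ x ∈ A, f x = 0) :
    ∫⁻ ω, φ (ξ ω A) * negExp (∫⁻ x, f x ∂(ξ ω)) ∂μ =
      (∫⁻ ω, φ (ξ ω A) ∂μ) * negExp (∫⁻ x, (1 - negExp (f x)) ∂ν) := by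
  -- Cutting off at `spanningSets` gives the nonzero level sets finite intensity; the approximations
  -- still increase to `f`.
  let F : ℕ → SimpleFunc E ℝ≥0∞ := fun n => (SimpleFunc.eapprox f n).restrict (spanningSets ν n)
  have hFx : ∀ n x, F n x = (spanningSets ν n).indicator (SimpleFunc.eapprox f n) x := fun n x =>
    SimpleFunc.restrict_apply _ (measurableSet_spanningSets ν n) x
  have hle : ∀ n x, F n x ≤ f x := fun n x => by
    rw [hFx]
    refine (Set.indicator_le_self _ _ x).trans ?_
    rw [← SimpleFunc.iSup_eapprox_apply hf x]
    exact le_iSup (fun n => SimpleFunc.eapprox f n x) n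
  have hmono : ∀ x, Monotone fun n => F n x := fun x m n hmn => by
    show F m x ≤ F n x
    rw [hFx, hFx]
    refine (Set.indicator_le_indicator (SimpleFunc.monotone_eapprox f hmn x)).trans ?_
    exact Set.indicator_le_indicator_of_subset (monotone_spanningSets ν hmn) (fun _ => zero_le) x
  have hlim : ∀ x, Tendsto (fun n => F n x) atTop (𝓝 (f x)) := fun x => by
    have h1 : Tendsto (fun n => SimpleFunc.eapprox f n x) atTop (𝓝 (f x)) := by
      rw [← SimpleFunc.iSup_eapprox_apply hf x]
      exact tendsto_atTop_iSup fun m n hmn => SimpleFunc.monotone_eapprox f hmn x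
    refine h1.congr' ?_
    filter_upwards [eventually_ge_atTop (spanningSetsIndex ν x)] with n hn
    rw [hFx, Set.indicator_of_mem]
    exact monotone_spanningSets ν hn (mem_spanningSetsIndex ν x)
  have hstep : ∀ n, ∫⁻ ω, φ (ξ ω A) * negExp (∫⁻ x, F n x ∂(ξ ω)) ∂μ =
      (∫⁻ ω, φ (ξ ω A) ∂μ) * negExp (∫⁻ x, (1 - negExp (F n x)) ∂ν) := fun n => by
    refine h.laplace_simpleFunc hξ hA hφ _ (fun x hx => ?_) fun c hc => ?_
    · exact le_antisymm ((hle n x).trans (hfA x hx).le) zero_le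
    · refine ((measure_mono fun x hx => ?_).trans_lt (measure_spanningSets_lt_top ν n)).ne
      by_contra hxn
      have : F n x = c := hx
      rw [hFx, Set.indicator_of_notMem hxn] at this
      exact hc this.symm
  have hint : ∀ m : Measure E, Tendsto (fun n => ∫⁻ x, F n x ∂m) atTop (𝓝 (∫⁻ x, f x ∂m)) :=
    fun m => lintegral_tendsto_of_tendsto_of_monotone (fun n => (F n).measurable.aemeasurable)
      (.of_forall hmono) (.of_forall hlim)
  have hint2 : Tendsto (fun n => ∫⁻ x, (1 - negExp (F n x)) ∂ν) atTop
      (𝓝 (∫⁻ x, (1 - negExp (f x)) ∂ν)) :=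
    lintegral_tendsto_of_tendsto_of_monotone
      (fun n => (measurable_const.sub (measurable_negExp.comp (F n).measurable)).aemeasurable)
      (.of_forall fun x m n hmn => tsub_le_tsub_left (negExp_antitone (hmono x hmn)) _)
      (.of_forall fun x => ENNReal.Tendsto.sub tendsto_const_nhds
        ((continuous_negExp.tendsto _).comp (hlim x)) (Or.inl ENNReal.one_ne_top))
  have hφfin : ∫⁻ ω, φ (ξ ω A) ∂μ ≠ ∞ :=
    ((lintegral_mono fun ω => hφ1 _).trans_lt (by simp)).ne
  have hφm : Measurable fun ω => φ (ξ ω A) := hφ.comp ((Measure.measurable_coe hA).comp hξ)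
  -- The inner integrals converge monotonically, the outer expectation by domination with `φ (ξ ω
  -- A)`.
  refine tendsto_nhds_unique (f := fun n => ∫⁻ ω, φ (ξ ω A) * negExp (∫⁻ x, F n x ∂(ξ ω)) ∂μ)
    (l := atTop) ?_ ?_
  · refine tendsto_lintegral_of_dominated_convergence (fun ω => φ (ξ ω A)) (fun n => ?_)
      (fun n => .of_forall fun ω => ?_) hφfin (.of_forall fun ω => ?_)
    · exact hφm.mul (measurable_negExp.comp ((Measure.measurable_lintegral (F n).measurable).comp hξ))
    · exact mul_le_of_le_one_right' (negExp_le_one _)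
    · exact ENNReal.Tendsto.const_mul ((continuous_negExp.tendsto _).comp (hint _))
        (Or.inr ((hφ1 _).trans_lt ENNReal.one_lt_top).ne)
  · simp_rw [hstep]
    exact ENNReal.Tendsto.const_mul ((continuous_negExp.tendsto _).comp hint2) (Or.inr hφfin)

end Laplace

/-! ### Void probabilities and multiple points -/

section Points

variable {E Ω : Type*} [MeasurableSpace E]

/-- The counting measure of a sequence of points. -/
noncomputable def countPoints (Y : ℕ → Ω → E) (ω : Ω) : Measure E :=
  Measure.sum fun n => Measure.dirac (Y n ω)

variable {Y : ℕ → Ω → E}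

lemma countPoints_apply {A : Set E} (hA : MeasurableSet A) (ω : Ω) :
    countPoints Y ω A = ∑' n, A.indicator 1 (Y n ω) := by
  simp [countPoints, Measure.sum_apply _ hA, Measure.dirac_apply' _ hA]

lemma measurable_countPoints [MeasurableSpace Ω] (hY : ∀ n, Measurable (Y n)) : Measurable (countPoints Y) := by
  refine Measure.measurable_of_measurable_coe _ fun A hA => ?_
  simp_rw [countPoints_apply hA]
  exact Measurable.tsum fun n => (measurable_one.indicator hA).comp (hY n)

lemma lintegral_countPoints {f : E → ℝ≥0∞} (hf : Measurable f) (ω : Ω) :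
    ∫⁻ x, f x ∂(countPoints Y ω) = ∑' n, f (Y n ω) := by
  simp [countPoints, lintegral_sum_measure, lintegral_dirac' _ hf]

lemma countPoints_eq_one_iff {A : Set E} (hA : MeasurableSet A) (ω : Ω) :
    countPoints Y ω A = 1 ↔ ∃ j, Y j ω ∈ A ∧ ∀ m, m ≠ j → Y m ω ∉ A := by
  rw [countPoints_apply hA]
  constructor
  · intro h
    obtain ⟨j, hj⟩ : ∃ j, Y j ω ∈ A := by
      by_contra! hn
      simp [Set.indicator_of_notMem (hn _)] at h
    refine ⟨j, hj, fun m hm hmA => ?_⟩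
    have := ENNReal.sum_le_tsum (f := fun n => A.indicator (1 : E → ℝ≥0∞) (Y n ω)) {m, j}
    rw [h, Finset.sum_pair hm, Set.indicator_of_mem hj, Set.indicator_of_mem hmA] at this
    norm_num at this
  · rintro ⟨j, hj, hm⟩
    rw [tsum_eq_single j fun m h => Set.indicator_of_notMem (hm m h) _, Set.indicator_of_mem hj]
    rfl

lemma countPoints_eq_zero_iff {A : Set E} (hA : MeasurableSet A) (ω : Ω) :
    countPoints Y ω A = 0 ↔ ∀ n, Y n ω ∉ A := by
  rw [countPoints_apply hA, ENNReal.tsum_eq_zero]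
  simp [Set.indicator_apply_eq_zero]

variable [MeasurableSpace Ω] {ν : Measure E} {μ : Measure Ω} (hP : IsPoissonProcess ν (countPoints Y) μ)
include hP

lemma IsPoissonProcess.measure_void [IsProbabilityMeasure μ] [SigmaFinite ν]
    (hY : ∀ n, Measurable (Y n)) {A : Set E}
    (hA : MeasurableSet A) : μ {ω | ∀ n, Y n ω ∉ A} = negExp (ν A) := by
  -- With the test function ∞ · 1_A the integral against the counting measure is 0 or ∞, so its
  -- `negExp` is the indicator of the void event. This also covers `A` of infinite intensity.
  have hf : Measurable (A.indicator fun _ => ∞ : E → ℝ≥0∞) := measurable_const.indicator hA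
  have h := hP.laplace (measurable_countPoints hY) MeasurableSet.empty
    (φ := fun _ => 1) measurable_const (fun _ => le_rfl) hf (by simp)
  have h1 : ∀ x, 1 - negExp (A.indicator (fun _ => ∞) x) = A.indicator 1 x := fun x => by
    by_cases hx : x ∈ A <;> simp [hx]
  have h2 : ∀ ω, negExp (∫⁻ x, A.indicator (fun _ => ∞) x ∂(countPoints Y ω)) =
      {ω | ∀ n, Y n ω ∉ A}.indicator 1 ω := fun ω => by
    rw [lintegral_indicator_const hA]
    by_cases hω : ∀ n, Y n ω ∉ A
    · rw [Set.indicator_of_mem (show ω ∈ {ω | ∀ n, Y n ω ∉ A} from hω),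
        (countPoints_eq_zero_iff hA ω).2 hω]
      simp
    · rw [Set.indicator_of_notMem (show ω ∉ {ω | ∀ n, Y n ω ∉ A} from hω),
        ENNReal.top_mul (mt (countPoints_eq_zero_iff hA ω).1 hω), negExp_top]
  have hm : MeasurableSet {ω | ∀ n, Y n ω ∉ A} := by
    simp only [Set.ofPred_forall]
    exact MeasurableSet.iInter fun n => (hY n) hA.compl
  simp_rw [h1, h2, one_mul] at h
  rw [lintegral_indicator_one hm, lintegral_indicator_one hA] at h
  simpa using h

lemma IsPoissonProcess.measure_eq_one {A : Set E} (hA : MeasurableSet A) (hν : ν A ≠ ∞) :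
    μ {ω | countPoints Y ω A = 1} = ν A * negExp (ν A) := by
  rw [(hP.hasLaw A hA hν).measure_eq (p := fun k => k = 1) (measurableSet_singleton 1),
    Measure.map_apply .of_discrete (show MeasurableSet {x : ℝ≥0∞ | x = 1} from
      measurableSet_singleton 1)]
  have : (fun k : ℕ => (k : ℝ≥0∞)) ⁻¹' {x | x = 1} = {1} := by ext k; simp
  rw [this, poissonMeasure_singleton]
  conv_rhs => rw [← ENNReal.coe_toNNReal hν, ← ENNReal.ofReal_coe_nnreal,
    negExp_ofReal NNReal.zero_le_coe, ← ENNReal.ofReal_mul NNReal.zero_le_coe]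
  simp [mul_comm]

lemma IsPoissonProcess.ae_finite {A : Set E} (hA : MeasurableSet A) (hν : ν A ≠ ∞) :
    ∀ᵐ ω ∂μ, {n | Y n ω ∈ A}.Finite := by
  have h : ∀ᵐ ω ∂μ, countPoints Y ω A ≠ ∞ := by
    refine ((hP.hasLaw A hA hν).ae_iff (p := fun k => k ≠ ∞) ?_).2 ?_
    · exact measurableSet_setOfPred.1 (measurableSet_singleton _).compl
    · exact (ae_map_iff (measurable_of_countable _).aemeasurable
        (show MeasurableSet {x : ℝ≥0∞ | x ≠ ∞} from (measurableSet_singleton _).compl)).2 (by simp)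
  filter_upwards [h] with ω hω
  rw [countPoints_apply hA] at hω
  refine (ENNReal.finite_const_le_of_tsum_ne_top hω one_ne_zero).subset fun n hn => ?_
  simp [Set.indicator_of_mem (show Y n ω ∈ A from hn)]

lemma IsPoissonProcess.ae_notMem [IsProbabilityMeasure μ] [SigmaFinite ν]
    (hY : ∀ n, Measurable (Y n)) {A : Set E} (hA : MeasurableSet A) (hν : ν A = 0) :
    ∀ᵐ ω ∂μ, ∀ n, Y n ω ∉ A := by
  have hm : MeasurableSet {ω | ∀ n, Y n ω ∉ A} := by
    simp only [Set.ofPred_forall]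
    exact MeasurableSet.iInter fun n => (hY n) hA.compl
  have h := hP.measure_void hY hA
  rw [hν, negExp_zero] at h
  exact (prob_compl_eq_zero_iff hm).2 h

/-- With t = ν A the probability is at most 1 - e^{-t} - t e^{-t}, and e^{-t} ≥ 1 - t bounds this by
t². A quadratic bound makes union bounds over fine partitions vanish. -/
lemma IsPoissonProcess.measure_two_le [IsProbabilityMeasure μ] [SigmaFinite ν]
    (hY : ∀ n, Measurable (Y n)) {A : Set E} (hA : MeasurableSet A) (hν : ν A ≠ ∞) :
    μ {ω | ∃ m n, m ≠ n ∧ Y m ω ∈ A ∧ Y n ω ∈ A} ≤ ν A ^ 2 := by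
  have hm0 : MeasurableSet {ω | countPoints Y ω A = 0} :=
    (Measure.measurable_coe hA).comp (measurable_countPoints hY) (measurableSet_singleton 0)
  have hm1 : MeasurableSet {ω | countPoints Y ω A = 1} :=
    (Measure.measurable_coe hA).comp (measurable_countPoints hY) (measurableSet_singleton 1)
  have h0 : μ {ω | countPoints Y ω A = 0} = negExp (ν A) := by
    simp_rw [countPoints_eq_zero_iff hA]
    exact hP.measure_void hY hA
  have hsub : {ω | ∃ m n, m ≠ n ∧ Y m ω ∈ A ∧ Y n ω ∈ A} ⊆
      ({ω | countPoints Y ω A = 0} ∪ {ω | countPoints Y ω A = 1})ᶜ := by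
    rintro ω ⟨m, n, hmn, hm, hn⟩ (h | h)
    · exact (countPoints_eq_zero_iff hA ω).1 h m hm
    · obtain ⟨j, -, hj⟩ := (countPoints_eq_one_iff hA ω).1 h
      by_cases hmj : m = j
      · exact hj n (fun h => hmn (hmj.trans h.symm)) hn
      · exact hj m hmj hm
  refine (measure_mono hsub).trans ?_
  rw [prob_compl_eq_one_sub (hm0.union hm1), measure_union _ hm1, h0, hP.measure_eq_one hA hν]
  · rw [tsub_le_iff_right, ← ENNReal.ofReal_toReal hν, negExp_ofReal ENNReal.toReal_nonneg]
    set t := (ν A).toReal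
    have ht : 0 ≤ t := ENNReal.toReal_nonneg
    rw [← ENNReal.ofReal_mul ht, ← ENNReal.ofReal_add (by positivity) (by positivity),
      ← ENNReal.ofReal_pow ht, ← ENNReal.ofReal_add (by positivity) (by positivity),
      ENNReal.one_le_ofReal]
    nlinarith [Real.add_one_le_exp (-t)]
  · exact Set.disjoint_left.2 fun ω (h : _ = _) (h' : _ = _) => by simp [h] at h'

end Points


/-! ### Poisson processes on the half-line -/

section Line

variable {Ω : Type*} [MeasurableSpace Ω] {μ : Measure Ω} [IsProbabilityMeasure μ]
  {Y : ℕ → Ω → ℝ} {c : ℝ}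

/-- The cells of length `1 / N` of the positive half-line. -/
def cell (N k : ℕ) : Set ℝ := Set.Ioc (k / N : ℝ) ((k + 1) / N)

lemma measurableSet_cell (N k : ℕ) : MeasurableSet (cell N k) := measurableSet_Ioc

/-- Cells are open on the left, hence the ceiling and the shift by one. This one formula yields both
that cells are disjoint and that they cover. -/
lemma mem_cell_iff {N : ℕ} (hN : 0 < N) {k : ℕ} {y : ℝ} :
    y ∈ cell N k ↔ ⌈y * N⌉₊ = k + 1 := by
  have hN' : (0 : ℝ) < N := by exact_mod_cast hN
  rw [Nat.ceil_eq_iff (by omega), cell, Set.mem_Ioc, div_lt_iff₀ hN', le_div_iff₀ hN']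
  simp

lemma exists_mem_cell {N : ℕ} (hN : 0 < N) {y : ℝ} (hy : 0 < y) : ∃ k, y ∈ cell N k := by
  have hN' : (0 : ℝ) < N := by exact_mod_cast hN
  have : 0 < ⌈y * N⌉₊ := Nat.ceil_pos.2 (by positivity)
  exact ⟨⌈y * N⌉₊ - 1, (mem_cell_iff hN).2 (by omega)⟩

lemma tsum_indicator_cell_le {N : ℕ} (hN : 0 < N) (y : ℝ) :
    ∑' k, (cell N k).indicator (1 : ℝ → ℝ≥0∞) y ≤ 1 := by
  rw [tsum_eq_single (⌈y * N⌉₊ - 1)]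
  · exact Set.indicator_apply_le' (fun _ => le_rfl) (fun _ => zero_le)
  · intro k hk
    refine Set.indicator_of_notMem (fun h => hk ?_) _
    have := (mem_cell_iff hN).1 h
    omega

lemma one_le_tsum_indicator_cell {N : ℕ} (hN : 0 < N) {y : ℝ} (hy : 0 < y) :
    1 ≤ ∑' k, (cell N k).indicator (1 : ℝ → ℝ≥0∞) y := by
  obtain ⟨k, hk⟩ := exists_mem_cell hN hy
  refine le_trans ?_ (ENNReal.le_tsum k)
  rw [Set.indicator_of_mem hk]
  rfl

/-- The measure `c dy` on the half-line. -/
noncomputable def halfLine (c : ℝ) : Measure ℝ :=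
  ENNReal.ofReal c • (volume : Measure ℝ).restrict (Set.Ici 0)

instance : SigmaFinite (halfLine c) :=
  inferInstanceAs (SigmaFinite (c.toNNReal • (volume : Measure ℝ).restrict (Set.Ici 0)))

lemma halfLine_cell (N k : ℕ) : halfLine c (cell N k) = ENNReal.ofReal c * ENNReal.ofReal (1 / N) := by
  rw [halfLine, Measure.smul_apply, Measure.restrict_apply (measurableSet_cell N k),
    Set.inter_eq_left.2, cell, Real.volume_Ioc, smul_eq_mul]
  · congr 2; ring
  · exact fun x hx => (lt_of_le_of_lt (by positivity) hx.1).le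

lemma halfLine_cell_ne_top (N k : ℕ) : halfLine c (cell N k) ≠ ∞ := by
  rw [halfLine_cell]; finiteness

variable (hP : IsPoissonProcess (halfLine c) (countPoints Y) μ) (hY : ∀ n, Measurable (Y n))
include hP hY

lemma ae_pos : ∀ᵐ ω ∂μ, ∀ n, 0 < Y n ω := by
  have h : halfLine c (Set.Iic 0) = 0 := by
    rw [halfLine, Measure.smul_apply, Measure.restrict_apply measurableSet_Iic,
      Set.Iic_inter_Ici, Set.Icc_self, Real.volume_singleton, smul_zero]
  filter_upwards [hP.ae_notMem hY measurableSet_Iic h] with ω hω n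
  simpa using hω n

omit [IsProbabilityMeasure μ] hY in
lemma ae_finite_le : ∀ᵐ ω ∂μ, ∀ R : ℝ, {n | Y n ω ≤ R}.Finite := by
  have h : ∀ᵐ ω ∂μ, ∀ k : ℕ, {n | Y n ω ∈ Set.Iic (k : ℝ)}.Finite := by
    refine ae_all_iff.2 fun k => hP.ae_finite measurableSet_Iic ?_
    rw [halfLine, Measure.smul_apply, Measure.restrict_apply measurableSet_Iic,
      Set.Iic_inter_Ici, Real.volume_Icc, smul_eq_mul]
    finiteness
  filter_upwards [h] with ω hω R
  obtain ⟨k, hk⟩ := exists_nat_ge R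
  exact (hω k).subset fun n (hn : Y n ω ≤ R) => hn.trans hk

/-- Coinciding points in (0, R] share a cell. There are R(N+1) cells of length 1/(N+1), each with
two points with probability at most (c/(N+1))², so the total is at most Rc²/(N+1) for every N. -/
lemma ae_injective : ∀ᵐ ω ∂μ, Function.Injective fun n => Y n ω := by
  have h : ∀ R : ℕ, ∀ᵐ ω ∂μ, ¬ ∃ m n, m ≠ n ∧ Y m ω = Y n ω ∧ 0 < Y n ω ∧ Y n ω ≤ R := by
    intro R
    have hb : ∀ N : ℕ, μ {ω | ∃ m n, m ≠ n ∧ Y m ω = Y n ω ∧ 0 < Y n ω ∧ Y n ω ≤ R} ≤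
        ENNReal.ofReal (R * c ^ 2 * (1 / ((N : ℝ) + 1))) := by
      intro N
      have hsub : {ω | ∃ m n, m ≠ n ∧ Y m ω = Y n ω ∧ 0 < Y n ω ∧ Y n ω ≤ R} ⊆
          ⋃ k ∈ Finset.range (R * (N + 1)),
            {ω | ∃ m n, m ≠ n ∧ Y m ω ∈ cell (N + 1) k ∧ Y n ω ∈ cell (N + 1) k} := by
        rintro ω ⟨m, n, hmn, he, h0, hR⟩
        obtain ⟨k, hk⟩ := exists_mem_cell (Nat.succ_pos N) h0
        refine Set.mem_biUnion (x := k) ?_ ⟨m, n, hmn, he ▸ hk, hk⟩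
        have h1 : (k : ℝ) / (N + 1 : ℕ) < R := hk.1.trans_le hR
        rw [div_lt_iff₀ (by positivity)] at h1
        simpa using (by exact_mod_cast h1 : k < R * (N + 1))
      refine (measure_mono hsub).trans ((measure_biUnion_finset_le _ _).trans ?_)
      refine (Finset.sum_le_sum fun k _ =>
        hP.measure_two_le hY (measurableSet_cell _ k) (halfLine_cell_ne_top _ k)).trans ?_
      simp_rw [halfLine_cell]
      rw [Finset.sum_const, Finset.card_range, nsmul_eq_mul]
      rcases le_total c 0 with hc | hc
      · simp [ENNReal.ofReal_of_nonpos hc]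
      rw [← ENNReal.ofReal_mul hc, ← ENNReal.ofReal_pow (by positivity), ← ENNReal.ofReal_natCast,
        ← ENNReal.ofReal_mul (by positivity)]
      refine le_of_eq (congrArg _ ?_)
      push_cast
      field_simp
    have hlim : Tendsto (fun N : ℕ => ENNReal.ofReal (R * c ^ 2 * (1 / ((N : ℝ) + 1)))) atTop
        (𝓝 0) := by
      have := (tendsto_one_div_add_atTop_nhds_zero_nat (𝕜 := ℝ)).const_mul (R * c ^ 2)
      simpa using ENNReal.tendsto_ofReal this
    have h0 := le_antisymm (ge_of_tendsto' hlim hb) zero_le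
    rw [ae_iff]
    simpa using h0
  filter_upwards [ae_all_iff.2 h, ae_pos hP hY] with ω hω hpos m n hmn
  by_contra hne
  obtain ⟨R, hR⟩ := exists_nat_ge (Y n ω)
  exact hω R ⟨m, n, hne, hmn, hpos n, hR⟩

end Line

/-! ### A Campbell–Mecke formula for products, by discretization -/

section Campbell

variable {Ω : Type*} [MeasurableSpace Ω] {μ : Measure Ω} [IsProbabilityMeasure μ]
  {Y : ℕ → Ω → ℝ} {c : ℝ}

/-- The product of `negExp (F (y j) (y m))` over all indices `m ≠ j`. -/
noncomputable def palmProd (F : ℝ → ℝ → ℝ≥0∞) (y : ℕ → ℝ) (j : ℕ) : ℝ≥0∞ :=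
  negExp (∑' m, if m = j then 0 else F (y j) (y m))

lemma measurable_palmProd {F : ℝ → ℝ → ℝ≥0∞} (hF : Measurable (Function.uncurry F)) (j : ℕ) :
    Measurable fun y => palmProd F y j := by
  refine measurable_negExp.comp (Measurable.tsum fun m => ?_)
  split_ifs
  · exact measurable_const
  · exact hF.comp (f := fun y : ℕ → ℝ => (y j, y m))
      ((measurable_pi_apply j).prodMk (measurable_pi_apply m))

/-- The contribution of the event that there is exactly one point in `A`. -/
noncomputable def cellTerm (Y : ℕ → Ω → ℝ) (A : Set ℝ) (f : ℝ → ℝ≥0∞) (ω : Ω) : ℝ≥0∞ :=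
  ({1} : Set ℝ≥0∞).indicator 1 (countPoints Y ω A) *
    negExp (∫⁻ y, Aᶜ.indicator f y ∂(countPoints Y ω))

omit [MeasurableSpace Ω] in
lemma cellTerm_eq {A : Set ℝ} (hA : MeasurableSet A) {f : ℝ → ℝ≥0∞} (hf : Measurable f) {ω : Ω}
    {j : ℕ} (hj : Y j ω ∈ A) (hm : ∀ m, m ≠ j → Y m ω ∉ A) :
    cellTerm Y A f ω = negExp (∑' m, if m = j then 0 else f (Y m ω)) := by
  rw [cellTerm, lintegral_countPoints (hf.indicator hA.compl),
    (countPoints_eq_one_iff hA ω).2 ⟨j, hj, hm⟩]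
  simp only [Set.mem_singleton_iff, Set.indicator_of_mem, Pi.one_apply, one_mul]
  congr 2
  ext m
  split_ifs with h
  · rw [h, Set.indicator_of_notMem (by simpa using hj)]
  · rw [Set.indicator_of_mem (hm m h)]

omit [MeasurableSpace Ω] in
-- If `A` holds a single point, freezing the first argument of `F` at `b` only lowers the product
-- for that point; otherwise `cellTerm` vanishes.
lemma cellTerm_le {A : Set ℝ} (hA : MeasurableSet A) {F : ℝ → ℝ → ℝ≥0∞}
    {b : ℝ} (hF : Measurable (F b)) (hb : ∀ r ∈ A, ∀ y, F r y ≤ F b y) (ω : Ω) :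
    cellTerm Y A (F b) ω ≤
      ∑' j, A.indicator 1 (Y j ω) * palmProd F (fun n => Y n ω) j := by
  by_cases h : countPoints Y ω A = 1
  · obtain ⟨j, hj, hm⟩ := (countPoints_eq_one_iff hA ω).1 h
    rw [cellTerm_eq hA hF hj hm]
    refine le_trans ?_ (ENNReal.le_tsum j)
    rw [Set.indicator_of_mem hj, Pi.one_apply, one_mul]
    refine negExp_antitone (ENNReal.tsum_le_tsum fun m => ?_)
    split_ifs
    · exact le_rfl
    · exact hb _ hj _
  · simp [cellTerm, h]

omit [MeasurableSpace Ω] in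
-- A δ-isolated point is alone in a set whose points are less than δ apart. Points that share the
-- set would not be seen by `cellTerm`, hence the restriction to isolated ones.
lemma le_cellTerm {A : Set ℝ} (hA : MeasurableSet A) {F : ℝ → ℝ → ℝ≥0∞}
    {a : ℝ} (hF : Measurable (F a)) (ha : ∀ r ∈ A, ∀ y, F a y ≤ F r y) {ω : Ω} {δ : ℝ}
    (hδ : ∀ r ∈ A, ∀ y ∈ A, |r - y| < δ) :
    ∑' j, A.indicator 1 (Y j ω) * ({j | ∀ m, m ≠ j → δ ≤ |Y m ω - Y j ω|}.indicator
      (palmProd F (fun n => Y n ω)) j) ≤ cellTerm Y A (F a) ω := by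
  set I := {j | ∀ m, m ≠ j → δ ≤ |Y m ω - Y j ω|}
  by_cases h : ∃ j, Y j ω ∈ A ∧ j ∈ I
  · obtain ⟨j, hj, hI⟩ := h
    have hm : ∀ m, m ≠ j → Y m ω ∉ A := fun m hmj hmA =>
      absurd (hI m hmj) (not_le.2 (hδ _ hmA _ hj))
    rw [tsum_eq_single j fun m hmj => by rw [Set.indicator_of_notMem (hm m hmj), zero_mul],
      Set.indicator_of_mem hj, Set.indicator_of_mem hI, Pi.one_apply, one_mul,
      cellTerm_eq hA hF hj hm]
    refine negExp_antitone (ENNReal.tsum_le_tsum fun m => ?_)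
    split_ifs
    · exact le_rfl
    · exact ha _ hj _
  · push Not at h
    refine le_trans (le_of_eq ?_) zero_le
    refine ENNReal.tsum_eq_zero.2 fun j => ?_
    by_cases hj : Y j ω ∈ A
    · rw [Set.indicator_of_notMem (h j hj), mul_zero]
    · rw [Set.indicator_of_notMem hj, zero_mul]

/-- The count in `A` is independent of the configuration off `A`, and equals one with probability
ν(A) e^{-ν(A)}. -/
lemma lintegral_cellTerm {ν : Measure ℝ} [SigmaFinite ν]
    (hP : IsPoissonProcess ν (countPoints Y) μ)
    (hY : ∀ n, Measurable (Y n)) {A : Set ℝ} (hA : MeasurableSet A) (hν : ν A ≠ ∞)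
    {f : ℝ → ℝ≥0∞} (hf : Measurable f) :
    ∫⁻ ω, cellTerm Y A f ω ∂μ =
      ν A * negExp (ν A) * negExp (∫⁻ y, (1 - negExp (Aᶜ.indicator f y)) ∂ν) := by
  have hm1 : MeasurableSet {ω | countPoints Y ω A = 1} :=
    (Measure.measurable_coe hA).comp (measurable_countPoints hY) (measurableSet_singleton 1)
  unfold cellTerm
  rw [hP.laplace (measurable_countPoints hY) hA (measurable_one.indicator
    (measurableSet_singleton 1)) (fun k => Set.indicator_le_self _ _ k)
    (hf.indicator hA.compl) (fun x hx => by simp [hx]), ← hP.measure_eq_one hA hν,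
    ← lintegral_indicator_one hm1]
  rfl

lemma measurable_cellTerm (hY : ∀ n, Measurable (Y n)) {A : Set ℝ} (hA : MeasurableSet A)
    {f : ℝ → ℝ≥0∞} (hf : Measurable f) : Measurable (cellTerm Y A f) :=
  ((measurable_one.indicator (measurableSet_singleton 1)).comp
    ((Measure.measurable_coe hA).comp (measurable_countPoints hY))).mul
    (measurable_negExp.comp
      ((Measure.measurable_lintegral (hf.indicator hA.compl)).comp (measurable_countPoints hY)))

/-- Extending the integral from the complement of `A` to the whole line only lowers its `negExp`. -/
lemma le_lintegral_cellTerm {ν : Measure ℝ} [SigmaFinite ν]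
    (hP : IsPoissonProcess ν (countPoints Y) μ)
    (hY : ∀ n, Measurable (Y n)) {A : Set ℝ} (hA : MeasurableSet A) (hν : ν A ≠ ∞)
    {f : ℝ → ℝ≥0∞} (hf : Measurable f) :
    ν A * negExp (ν A) * negExp (∫⁻ y, (1 - negExp (f y)) ∂ν) ≤ ∫⁻ ω, cellTerm Y A f ω ∂μ := by
  rw [lintegral_cellTerm hP hY hA hν hf]
  gcongr
  refine negExp_antitone (lintegral_mono fun y => tsub_le_tsub_left (negExp_antitone ?_) _)
  exact Set.indicator_le_self _ _ y

/-- The factor e^{-ν(A)} pays for the part of the integral over `A` that is missing, since 1 -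
e^{-f} ≤ 1 there. -/
lemma lintegral_cellTerm_le {ν : Measure ℝ} [SigmaFinite ν]
    (hP : IsPoissonProcess ν (countPoints Y) μ)
    (hY : ∀ n, Measurable (Y n)) {A : Set ℝ} (hA : MeasurableSet A) (hν : ν A ≠ ∞)
    {f : ℝ → ℝ≥0∞} (hf : Measurable f) :
    ∫⁻ ω, cellTerm Y A f ω ∂μ ≤ ν A * negExp (∫⁻ y, (1 - negExp (f y)) ∂ν) := by
  rw [lintegral_cellTerm hP hY hA hν hf, mul_assoc, ← negExp_add]
  gcongr
  refine negExp_antitone ?_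
  rw [← lintegral_indicator_one hA, ← lintegral_add_left (measurable_one.indicator hA)]
  refine lintegral_mono fun y => ?_
  by_cases hy : y ∈ A
  · simp [hy]
  · simp [hy]

lemma tsum_exp_neg_grid {c K : ℝ} (hc : 0 < c) (hK : 0 < K) {N : ℕ} (hN : 0 < N) :
    ∑' k : ℕ, ENNReal.ofReal (Real.exp (-(c * (k / N) * K))) =
      ENNReal.ofReal (1 - Real.exp (-(c * K / N)))⁻¹ := by
  have hN' : (0 : ℝ) < N := by exact_mod_cast hN
  have h1 : ∀ k : ℕ, Real.exp (-(c * (k / N) * K)) = Real.exp (-(c * K / N)) ^ k := fun k => by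
    rw [← Real.exp_nat_mul]; congr 1; ring
  simp_rw [h1]
  have h2 := hasSum_geometric_of_lt_one (Real.exp_pos (-(c * K / N))).le
    (Real.exp_lt_one_iff.2 (neg_lt_zero.2 (by positivity)))
  rw [← ENNReal.ofReal_tsum_of_nonneg (fun k => by positivity) h2.summable, h2.tsum_eq]

/-- These are the left Riemann sums, with mesh 1/(N+1), of ∫ c e^{-crK} dr, summed as geometric
series; the limit comes from the derivative of 1 - e^{-cKt} at 0. -/
lemma tendsto_grid {c K : ℝ} (hc : 0 < c) (hK : 0 < K) :
    Tendsto (fun N : ℕ => c / ((N : ℝ) + 1) * (1 - Real.exp (-(c * K / ((N : ℝ) + 1))))⁻¹)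
      atTop (𝓝 (1 / K)) := by
  have hd : HasDerivAt (fun t => 1 - Real.exp (-(c * K * t))) (c * K) 0 := by
    have := ((((hasDerivAt_id (0 : ℝ)).const_mul (c * K)).neg).exp).const_sub 1
    simpa using this
  have h1 := hd.tendsto_slope_zero
  have h2 : Tendsto (fun N : ℕ => 1 / ((N : ℝ) + 1)) atTop (𝓝[≠] 0) :=
    tendsto_nhdsWithin_iff.2 ⟨tendsto_one_div_add_atTop_nhds_zero_nat,
      .of_forall fun N => by simp; positivity⟩
  have h3 := ((h1.comp h2).inv₀ (by positivity)).const_mul c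
  have h4 : c * (c * K)⁻¹ = 1 / K := by field_simp
  rw [h4] at h3
  refine h3.congr fun N => ?_
  simp only [Function.comp, zero_add, mul_zero, neg_zero, Real.exp_zero, sub_self, sub_zero,
    smul_eq_mul, mul_inv, one_div, inv_inv]
  rw [div_eq_mul_inv c, div_eq_mul_inv (c * K)]
  ring


variable {F : ℝ → ℝ → ℝ≥0∞} {K : ℝ}

/-- Cells with several points are dropped and `F` is frozen at the right end of each cell. The cost
is e^{-c/N} from having exactly one point, and e^{-cK/N} from moving the left end to the right end.
-/
lemma le_lintegral_tsum_palmProd (hc : 0 < c) (hP : IsPoissonProcess (halfLine c) (countPoints Y) μ)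
    (hY : ∀ n, Measurable (Y n)) (hF : Measurable (Function.uncurry F))
    (hmono : ∀ r r' y, 0 ≤ r → r ≤ r' → F r y ≤ F r' y) (hK : 0 < K)
    (hint : ∀ r, 0 ≤ r → ∫⁻ y, (1 - negExp (F r y)) ∂(halfLine c) = ENNReal.ofReal (c * r * K))
    {N : ℕ} (hN : 0 < N) :
    ENNReal.ofReal (c / N * (1 - Real.exp (-(c * K / N)))⁻¹ *
      (Real.exp (-(c * (1 / N))) * Real.exp (-(c * K / N)))) ≤
      ∫⁻ ω, ∑' j, palmProd F (fun n => Y n ω) j ∂μ := by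
  have hN' : (0 : ℝ) < N := by exact_mod_cast hN
  have hFr : ∀ r, Measurable (F r) := fun r => hF.comp measurable_prodMk_left
  have h1 : ∑' k : ℕ, ∫⁻ ω, cellTerm Y (cell N k) (F ((k + 1) / N)) ω ∂μ ≤
      ∫⁻ ω, ∑' j, palmProd F (fun n => Y n ω) j ∂μ := by
    rw [← lintegral_tsum fun k =>
      (measurable_cellTerm hY (measurableSet_cell N k) (hFr _)).aemeasurable]
    refine lintegral_mono fun ω => ?_
    calc ∑' k : ℕ, cellTerm Y (cell N k) (F ((k + 1) / N)) ω
        ≤ ∑' k : ℕ, ∑' j, (cell N k).indicator 1 (Y j ω) * palmProd F (fun n => Y n ω) j :=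
          ENNReal.tsum_le_tsum fun k => cellTerm_le (measurableSet_cell N k) (hFr _)
            (fun r hr y => hmono r _ y (lt_of_le_of_lt (by positivity) hr.1).le hr.2) ω
      _ = ∑' j, (∑' k : ℕ, (cell N k).indicator 1 (Y j ω)) * palmProd F (fun n => Y n ω) j := by
          rw [ENNReal.tsum_comm]
          simp_rw [ENNReal.tsum_mul_right]
      _ ≤ ∑' j, palmProd F (fun n => Y n ω) j := ENNReal.tsum_le_tsum fun j =>
          mul_le_of_le_one_left' (tsum_indicator_cell_le hN _)
  refine le_trans ?_ h1
  refine le_trans ?_ (ENNReal.tsum_le_tsum fun k => le_lintegral_cellTerm hP hY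
    (measurableSet_cell N k) (halfLine_cell_ne_top N k) (hFr _))
  have hexp : Real.exp (-(c * K / N)) < 1 := Real.exp_lt_one_iff.2 (neg_lt_zero.2 (by positivity))
  have hE : ∀ k : ℕ, halfLine c (cell N k) * negExp (halfLine c (cell N k)) *
      negExp (∫⁻ y, (1 - negExp (F ((k + 1) / N) y)) ∂(halfLine c)) =
      ENNReal.ofReal (c / N * (Real.exp (-(c * (1 / N))) * Real.exp (-(c * K / N)))) *
        ENNReal.ofReal (Real.exp (-(c * (k / N) * K))) := fun k => by
    rw [halfLine_cell, hint _ (by positivity), ← ENNReal.ofReal_mul hc.le,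
      negExp_ofReal (by positivity), negExp_ofReal (by positivity), ← ENNReal.ofReal_mul
      (by positivity), ← ENNReal.ofReal_mul (by positivity), ← ENNReal.ofReal_mul (by positivity)]
    have : -(c * ((k + 1) / N) * K) = -(c * K / N) + -(c * (k / N) * K) := by ring
    rw [this, Real.exp_add]
    congr 1
    ring
  simp_rw [hE]
  rw [ENNReal.tsum_mul_left, tsum_exp_neg_grid hc hK hN, ← ENNReal.ofReal_mul (by positivity)]
  refine le_of_eq (congrArg _ ?_)
  ring

/-- The mirror image of the lower bound, with `F` frozen at the left end of each cell; every
positive point lies in some cell. -/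
lemma lintegral_tsum_isolated_palmProd_le (hc : 0 < c) (hP : IsPoissonProcess (halfLine c) (countPoints Y) μ)
    (hY : ∀ n, Measurable (Y n)) (hF : Measurable (Function.uncurry F))
    (hmono : ∀ r r' y, 0 ≤ r → r ≤ r' → F r y ≤ F r' y) (hK : 0 < K)
    (hint : ∀ r, 0 ≤ r → ∫⁻ y, (1 - negExp (F r y)) ∂(halfLine c) = ENNReal.ofReal (c * r * K))
    {N : ℕ} (hN : 0 < N) :
    ∫⁻ ω, ∑' j, {j | ∀ m, m ≠ j → 1 / (N : ℝ) ≤ |Y m ω - Y j ω|}.indicator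
      (palmProd F (fun n => Y n ω)) j ∂μ ≤
      ENNReal.ofReal (c / N * (1 - Real.exp (-(c * K / N)))⁻¹) := by
  have hN' : (0 : ℝ) < N := by exact_mod_cast hN
  have hFr : ∀ r, Measurable (F r) := fun r => hF.comp measurable_prodMk_left
  have h1 : ∫⁻ ω, ∑' j, {j | ∀ m, m ≠ j → 1 / (N : ℝ) ≤ |Y m ω - Y j ω|}.indicator
      (palmProd F (fun n => Y n ω)) j ∂μ ≤
      ∑' k : ℕ, ∫⁻ ω, cellTerm Y (cell N k) (F (k / N)) ω ∂μ := by
    rw [← lintegral_tsum fun k =>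
      (measurable_cellTerm hY (measurableSet_cell N k) (hFr _)).aemeasurable]
    refine lintegral_mono_ae ?_
    filter_upwards [ae_pos hP hY] with ω hω
    set G := {j | ∀ m, m ≠ j → 1 / (N : ℝ) ≤ |Y m ω - Y j ω|}.indicator
      (palmProd F (fun n => Y n ω))
    calc ∑' j, G j ≤ ∑' j, (∑' k : ℕ, (cell N k).indicator 1 (Y j ω)) * G j :=
          ENNReal.tsum_le_tsum fun j =>
            le_mul_of_one_le_left' (one_le_tsum_indicator_cell hN (hω j))
      _ = ∑' k : ℕ, ∑' j, (cell N k).indicator 1 (Y j ω) * G j := by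
          rw [ENNReal.tsum_comm]
          simp_rw [ENNReal.tsum_mul_right]
      _ ≤ _ := ENNReal.tsum_le_tsum fun k => le_cellTerm (measurableSet_cell N k) (hFr _)
            (fun r hr y => hmono _ r y (by positivity) hr.1.le) ?_
    intro r hr y hy
    have h2 : ((k : ℝ) + 1) / N = k / N + 1 / N := by ring
    rw [cell, Set.mem_Ioc, h2] at hr hy
    rw [abs_lt]
    constructor <;> linarith [hr.1, hr.2, hy.1, hy.2]
  refine h1.trans ((ENNReal.tsum_le_tsum fun k => lintegral_cellTerm_le hP hY
    (measurableSet_cell N k) (halfLine_cell_ne_top N k) (hFr _)).trans (le_of_eq ?_))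
  have hE : ∀ k : ℕ, halfLine c (cell N k) *
      negExp (∫⁻ y, (1 - negExp (F (k / N) y)) ∂(halfLine c)) =
      ENNReal.ofReal (c / N) * ENNReal.ofReal (Real.exp (-(c * (k / N) * K))) := fun k => by
    rw [halfLine_cell, hint _ (by positivity), ← ENNReal.ofReal_mul hc.le,
      negExp_ofReal (by positivity)]
    congr 2
    ring
  simp_rw [hE]
  rw [ENNReal.tsum_mul_left, tsum_exp_neg_grid hc hK hN, ← ENNReal.ofReal_mul (by positivity)]

/-- The sum over the points `r` of a Poisson process on the half-line of the product, over the other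
points `y`, of `negExp (F r y)` has mean `1 / K`. -/
theorem lintegral_tsum_palmProd (hc : 0 < c)
    (hP : IsPoissonProcess (halfLine c) (countPoints Y) μ)
    (hY : ∀ n, Measurable (Y n)) (hF : Measurable (Function.uncurry F))
    (hmono : ∀ r r' y, 0 ≤ r → r ≤ r' → F r y ≤ F r' y) (hK : 0 < K)
    (hint : ∀ r, 0 ≤ r → ∫⁻ y, (1 - negExp (F r y)) ∂(halfLine c) = ENNReal.ofReal (c * r * K)) :
    ∫⁻ ω, ∑' j, palmProd F (fun n => Y n ω) j ∂μ = ENNReal.ofReal (1 / K) := by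
  have hYv : Measurable fun ω n => Y n ω := measurable_pi_lambda _ hY
  refine le_antisymm ?_ ?_
  · let G : ℕ → Ω → ℝ≥0∞ := fun N ω =>
      ∑' j, {j | ∀ m, m ≠ j → 1 / ((N : ℝ) + 1) ≤ |Y m ω - Y j ω|}.indicator
        (palmProd F (fun n => Y n ω)) j
    have hG : ∀ N, ∫⁻ ω, G N ω ∂μ ≤
        ENNReal.ofReal (c / ((N : ℝ) + 1) * (1 - Real.exp (-(c * K / ((N : ℝ) + 1))))⁻¹) :=
      fun N => by
        have := lintegral_tsum_isolated_palmProd_le hc hP hY hF hmono hK hint (Nat.succ_pos N)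
        push_cast at this
        exact this
    have hGm : ∀ N, Measurable (G N) := fun N => by
      refine Measurable.tsum fun j => ?_
      have hs : MeasurableSet {ω | ∀ m, m ≠ j → 1 / ((N : ℝ) + 1) ≤ |Y m ω - Y j ω|} := by
        simp only [Set.ofPred_forall]
        exact MeasurableSet.iInter fun m => MeasurableSet.iInter fun _ =>
          measurableSet_le measurable_const ((hY m).sub (hY j)).abs
      exact ((measurable_palmProd hF j).comp hYv).indicator hs
    have hmonoG : ∀ ω, Monotone fun N => G N ω := fun ω M N hMN => by
      refine ENNReal.tsum_le_tsum fun j => ?_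
      refine Set.indicator_le_indicator_of_subset (fun j hj m hm => ?_) (fun _ => zero_le) j
      exact (one_div_le_one_div_of_le (by positivity) (by gcongr)).trans (hj m hm)
    -- Points are almost surely distinct and locally finite, so each is isolated at all fine scales,
    -- and monotone convergence removes the isolation condition.
    have hsup : ∀ᵐ ω ∂μ, ∑' j, palmProd F (fun n => Y n ω) j ≤ ⨆ N, G N ω := by
      filter_upwards [ae_injective hP hY, ae_finite_le hP] with ω hinj hfin
      have hj : ∀ j, ∃ N : ℕ, ∀ M, N ≤ M → ∀ m, m ≠ j →
          1 / ((M : ℝ) + 1) ≤ |Y m ω - Y j ω| := by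
        intro j
        -- Only the finitely many points below `Y j ω + 1` need care; all others are more than 1 ≥
        -- 1/(M+1) away.
        have hev : ∀ᶠ M : ℕ in atTop, ∀ m ∈ {n | Y n ω ≤ Y j ω + 1}, m ≠ j →
            1 / ((M : ℝ) + 1) ≤ |Y m ω - Y j ω| := by
          refine ((hfin (Y j ω + 1)).eventually_all).2 fun m _ => ?_
          by_cases hm : m = j
          · exact .of_forall fun _ h => absurd hm h
          · have : 0 < |Y m ω - Y j ω| := abs_pos.2 (sub_ne_zero.2 (hinj.ne hm))
            filter_upwards [(tendsto_one_div_add_atTop_nhds_zero_nat (𝕜 := ℝ)).eventually_le_const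
              this] with M hM _ using hM
        obtain ⟨N, hN⟩ := eventually_atTop.1 hev
        refine ⟨N, fun M hM m hm => ?_⟩
        by_cases hle : Y m ω ≤ Y j ω + 1
        · exact hN M hM m hle hm
        · have h1 : 1 / ((M : ℝ) + 1) ≤ 1 := by
            rw [div_le_one (by positivity)]; linarith [(Nat.cast_nonneg M : (0 : ℝ) ≤ M)]
          exact h1.trans ((by linarith [not_le.1 hle] : (1 : ℝ) ≤ Y m ω - Y j ω).trans
            (le_abs_self _))
      choose N hN using hj
      rw [ENNReal.tsum_eq_iSup_nat]
      refine iSup_le fun n => ?_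
      refine le_trans ?_ (le_iSup _ ((Finset.range n).sup N))
      refine le_trans (Finset.sum_le_sum fun j hj => ?_) (ENNReal.sum_le_tsum (Finset.range n))
      rw [Set.indicator_of_mem]
      exact hN j _ (Finset.le_sup hj)
    refine (lintegral_mono_ae hsup).trans ?_
    rw [lintegral_iSup hGm (fun M N h ω => hmonoG ω h)]
    have hlim : Tendsto (fun N => ∫⁻ ω, G N ω ∂μ) atTop (𝓝 (⨆ N, ∫⁻ ω, G N ω ∂μ)) :=
      tendsto_atTop_iSup fun M N h => lintegral_mono fun ω => hmonoG ω h
    exact le_of_tendsto_of_tendsto' hlim (ENNReal.tendsto_ofReal (tendsto_grid hc hK)) hG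
  · have hlow := fun N : ℕ => le_lintegral_tsum_palmProd hc hP hY hF hmono hK hint (Nat.succ_pos N)
    have h0 := tendsto_one_div_add_atTop_nhds_zero_nat (𝕜 := ℝ)
    have h1 : ∀ a : ℝ, Tendsto (fun N : ℕ => Real.exp (-(a * (1 / ((N : ℝ) + 1))))) atTop (𝓝 1) :=
      fun a => by
        have := (Real.continuous_exp.tendsto _).comp (h0.const_mul a).neg
        simpa [Function.comp_def] using this
    have := (tendsto_grid hc hK).mul ((h1 c).mul (h1 (c * K)))
    simp only [mul_one, Nat.succ_eq_add_one, Nat.cast_add, Nat.cast_one] at this hlow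
    refine le_of_tendsto' (ENNReal.tendsto_ofReal this) fun N => ?_
    simpa [div_eq_mul_inv] using hlow N

end Campbell

/-! ### Squared distances as a Poisson process on the half-line -/

section Map

variable {E E' Ω : Type*} [MeasurableSpace E] [MeasurableSpace E'] [MeasurableSpace Ω]
  {ν : Measure E} {μ : Measure Ω}

lemma IsPoissonProcess.map {X : ℕ → Ω → E} (hP : IsPoissonProcess ν (countPoints X) μ)
    {g : E → E'} (hg : Measurable g) :
    IsPoissonProcess (ν.map g) (countPoints fun n ω => g (X n ω)) μ := by
  have h : ∀ s, MeasurableSet s → ∀ ω, countPoints (fun n ω => g (X n ω)) ω s =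
      countPoints X ω (g ⁻¹' s) := fun s hs ω => by
    rw [countPoints_apply hs, countPoints_apply (hg hs)]
    rfl
  refine ⟨fun s hs hν => ?_, fun k s hs hd => ?_⟩
  · rw [Measure.map_apply hg hs] at hν ⊢
    simp_rw [h s hs]
    exact hP.hasLaw _ (hg hs) hν
  · simp_rw [fun i ω => h (s i) (hs i) ω]
    exact hP.indep k _ (fun i => hg (hs i)) fun i j hij => (hd hij).preimage g

end Map

lemma halfLine_Iic {c : ℝ} (b : ℝ) : halfLine c (Set.Iic b) = ENNReal.ofReal c * ENNReal.ofReal b := by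
  rw [halfLine, Measure.smul_apply, Measure.restrict_apply measurableSet_Iic, Set.Iic_inter_Ici,
    Real.volume_Icc, sub_zero, smul_eq_mul]

/-- A disc of radius √b has area πb, so the two measures agree on every `Set.Iic b`, which
determines them. -/
lemma map_dist_sq (lam : ℝ) (hlam : 0 ≤ lam) (z : Plane) :
    (ENNReal.ofReal lam • (volume : Measure Plane)).map (fun x => dist x z ^ 2) =
      halfLine (lam * Real.pi) := by
  have hm : Measurable fun x : Plane => dist x z ^ 2 := by fun_prop
  have hI : ∀ b, (ENNReal.ofReal lam • (volume : Measure Plane)).map (fun x => dist x z ^ 2)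
      (Set.Iic b) = halfLine (lam * Real.pi) (Set.Iic b) := by
    intro b
    rw [Measure.map_apply hm measurableSet_Iic, halfLine_Iic, Measure.smul_apply]
    rcases lt_or_ge b 0 with hb | hb
    · have : (fun x : Plane => dist x z ^ 2) ⁻¹' Set.Iic b = ∅ := by
        ext x
        simp only [Set.mem_preimage, Set.mem_Iic, Set.mem_empty_iff_false, iff_false, not_le]
        exact hb.trans_le (sq_nonneg _)
      simp [this, ENNReal.ofReal_of_nonpos hb.le]
    · have : (fun x : Plane => dist x z ^ 2) ⁻¹' Set.Iic b = Metric.closedBall z (Real.sqrt b) := by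
        ext x
        simp [Real.le_sqrt dist_nonneg hb]
      rw [this, EuclideanSpace.volume_closedBall_fin_two, ← ENNReal.ofReal_pow (Real.sqrt_nonneg _),
        Real.sq_sqrt hb, ENNReal.ofReal_mul hlam, smul_eq_mul, mul_assoc]
      congr 1
      rw [mul_comm]
  symm
  have : IsLocallyFiniteMeasure (halfLine (lam * Real.pi)) :=
    inferInstanceAs (IsLocallyFiniteMeasure
      ((lam * Real.pi).toNNReal • (volume : Measure ℝ).restrict (Set.Ici 0)))
  refine Measure.ext_of_Ioc _ _ fun a b hab => ?_
  have hfin : ∀ b, halfLine (lam * Real.pi) (Set.Iic b) ≠ ∞ := fun b => by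
    rw [halfLine_Iic]; finiteness
  have hab' : Set.Ioc a b = Set.Iic b \ Set.Iic a := by
    ext x
    simp [and_comm]
  rw [hab', measure_sdiff (Set.Iic_subset_Iic.2 hab.le)
    measurableSet_Iic.nullMeasurableSet (hfin a), measure_sdiff (Set.Iic_subset_Iic.2 hab.le)
    measurableSet_Iic.nullMeasurableSet (by rw [hI]; exact hfin a), hI, hI]

lemma isPoissonProcess_dist_sq {Ω : Type*} [MeasurableSpace Ω] {μ : Measure Ω} {lam : ℝ}
    (hlam : 0 ≤ lam) {X : ℕ → Ω → Plane}
    (hP : IsPoissonProcess (ENNReal.ofReal lam • (volume : Measure Plane)) (countPoints X) μ)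
    (z : Plane) : IsPoissonProcess (halfLine (lam * Real.pi))
      (countPoints fun n ω => dist (X n ω) z ^ 2) μ := by
  rw [← map_dist_sq lam hlam z]
  exact hP.map (g := fun x => dist x z ^ 2) (by fun_prop)

/-! ### The mean factor of one interferer and its integral -/

section Factor

variable (T α q p : ℝ)

/-- The mean of the interference factor of a device at squared distance `y` when the serving
device is at squared distance `r`. -/
noncomputable def interferenceFactor (r y : ℝ) : ℝ :=
  1 - q + q / (1 + T * (r / |y|) ^ (α / 2))

/-- The interference factor times the probability that the device does not prevent the one at
squared distance `r` from being the closest that caches a portion of probability `p`. -/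
noncomputable def palmFactor (r y : ℝ) : ℝ :=
  (if y < r then 1 - p else 1) * interferenceFactor T α q r y

/-- Minus the logarithm of `palmFactor`, infinite where that factor vanishes: the form in which
`lintegral_tsum_palmProd` takes its input. -/
noncomputable def palmExponent (r y : ℝ) : ℝ≥0∞ :=
  (-(ENNReal.log (ENNReal.ofReal (palmFactor T α q p r y)))).toENNReal

variable {T α q p}

lemma interferenceFactor_nonneg (hT : 0 < T) (hq0 : 0 ≤ q) (hq1 : q ≤ 1) {r : ℝ} (hr : 0 ≤ r)
    (y : ℝ) : 0 ≤ interferenceFactor T α q r y := by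
  unfold interferenceFactor
  have : 0 ≤ T * (r / |y|) ^ (α / 2) := by positivity
  have : 0 ≤ q / (1 + T * (r / |y|) ^ (α / 2)) := by positivity
  linarith

lemma interferenceFactor_le_one (hT : 0 < T) (hq0 : 0 ≤ q) {r : ℝ} (hr : 0 ≤ r)
    (y : ℝ) : interferenceFactor T α q r y ≤ 1 := by
  unfold interferenceFactor
  have h0 : 0 ≤ T * (r / |y|) ^ (α / 2) := by positivity
  have : q / (1 + T * (r / |y|) ^ (α / 2)) ≤ q := div_le_self hq0 (by linarith)
  linarith

lemma interferenceFactor_anti (hT : 0 < T) (hα : 0 ≤ α) (hq0 : 0 ≤ q) {r r' : ℝ} (hr : 0 ≤ r)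
    (hrr : r ≤ r') (y : ℝ) :
    interferenceFactor T α q r' y ≤ interferenceFactor T α q r y := by
  unfold interferenceFactor
  gcongr

lemma palmFactor_nonneg (hT : 0 < T) (hq0 : 0 ≤ q) (hq1 : q ≤ 1) (hp1 : p ≤ 1) {r : ℝ}
    (hr : 0 ≤ r) (y : ℝ) : 0 ≤ palmFactor T α q p r y := by
  refine mul_nonneg ?_ (interferenceFactor_nonneg hT hq0 hq1 hr y)
  split_ifs <;> linarith

lemma palmFactor_le_one (hT : 0 < T) (hq0 : 0 ≤ q) (hq1 : q ≤ 1) (hp0 : 0 ≤ p) {r : ℝ}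
    (hr : 0 ≤ r) (y : ℝ) : palmFactor T α q p r y ≤ 1 := by
  refine mul_le_one₀ ?_ (interferenceFactor_nonneg hT hq0 hq1 hr y)
    (interferenceFactor_le_one hT hq0 hr y)
  split_ifs <;> linarith

lemma palmFactor_anti (hT : 0 < T) (hα : 0 ≤ α) (hq0 : 0 ≤ q) (hq1 : q ≤ 1) (hp0 : 0 ≤ p)
    (hp1 : p ≤ 1) {r r' : ℝ} (hr : 0 ≤ r) (hrr : r ≤ r') (y : ℝ) :
    palmFactor T α q p r' y ≤ palmFactor T α q p r y := by
  refine mul_le_mul ?_ (interferenceFactor_anti hT hα hq0 hr hrr y)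
    (interferenceFactor_nonneg hT hq0 hq1 (hr.trans hrr) y) ?_
  · split_ifs <;> linarith
  · split_ifs <;> linarith

lemma negExp_palmExponent (hT : 0 < T) (hq0 : 0 ≤ q) (hq1 : q ≤ 1) (hp0 : 0 ≤ p) {r : ℝ}
    (hr : 0 ≤ r) (y : ℝ) :
    negExp (palmExponent T α q p r y) = ENNReal.ofReal (palmFactor T α q p r y) :=
  exists_negExp_eq (ENNReal.ofReal_le_one.2 (palmFactor_le_one hT hq0 hq1 hp0 hr y))

lemma palmExponent_mono (hT : 0 < T) (hα : 0 ≤ α) (hq0 : 0 ≤ q) (hq1 : q ≤ 1) (hp0 : 0 ≤ p)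
    (hp1 : p ≤ 1) (r r' y : ℝ) (hr : 0 ≤ r) (hrr : r ≤ r') :
    palmExponent T α q p r y ≤ palmExponent T α q p r' y := by
  refine EReal.toENNReal_le_toENNReal (EReal.neg_le_neg_iff.2 (ENNReal.log_monotone ?_))
  exact ENNReal.ofReal_le_ofReal (palmFactor_anti hT hα hq0 hq1 hp0 hp1 hr hrr y)

lemma measurable_palmExponent : Measurable (Function.uncurry (palmExponent T α q p)) := by
  have h1 : Measurable fun z : ℝ × ℝ => palmFactor T α q p z.1 z.2 := by
    unfold palmFactor interferenceFactor
    refine Measurable.mul ?_ (by fun_prop)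
    exact Measurable.ite (measurableSet_lt measurable_snd measurable_fst) measurable_const
      measurable_const
  exact measurable_ereal_toENNReal.comp h1.ennreal_ofReal.ennreal_log.neg

/-- Here α > 2 is essential: the tail u^{-α/2} must be integrable. -/
lemma integrableOn_pathLoss (hα : 2 < α) :
    IntegrableOn (fun u : ℝ => 1 / (1 + u ^ (α / 2))) (Set.Ioi 0) := by
  have hm : Measurable fun u : ℝ => 1 / (1 + u ^ (α / 2)) := by fun_prop
  rw [← Set.Ioc_union_Ioi_eq_Ioi zero_le_one]
  refine IntegrableOn.union ?_ ?_
  · refine Integrable.mono' (g := fun _ => 1) (integrable_const _) hm.aestronglyMeasurable ?_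
    refine (ae_restrict_iff' measurableSet_Ioc).2 (.of_forall fun u hu => ?_)
    have h := Real.rpow_nonneg hu.1.le (α / 2)
    rw [Real.norm_of_nonneg (by positivity), div_le_one (by positivity)]
    linarith
  · refine Integrable.mono' (integrableOn_Ioi_rpow_of_lt (a := -(α / 2)) (by linarith) zero_lt_one)
      hm.aestronglyMeasurable ?_
    refine (ae_restrict_iff' measurableSet_Ioi).2 (.of_forall fun u hu => ?_)
    have hu0 : (0 : ℝ) < u := zero_lt_one.trans hu
    have h := Real.rpow_pos_of_pos hu0 (α / 2)
    rw [Real.norm_of_nonneg (by positivity), Real.rpow_neg hu0.le, one_div]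
    exact inv_anti₀ h (by linarith)

/-- The density of interference and blocking after rescaling the squared distance. -/
noncomputable def scaledLoss (T α q p u : ℝ) : ℝ :=
  if u < T ^ (-(2 / α)) then p + (1 - p) * (q * (1 / (1 + u ^ (α / 2))))
  else q * (1 / (1 + u ^ (α / 2)))

/-- Under u = y / (r T^{2/α}) the ratio T(r/y)^{α/2} becomes u^{-α/2} and y < r becomes u <
T^{-2/α}, so r survives only as a scale. -/
lemma one_sub_palmFactor (hT : 0 < T) (hα : 2 < α) {r y : ℝ} (hr : 0 < r) (hy : 0 < y) :
    1 - palmFactor T α q p r y = scaledLoss T α q p ((r * T ^ (2 / α))⁻¹ * y) := by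
  have hα0 : 0 < α := by linarith
  have hκ : 0 < T ^ (2 / α) := Real.rpow_pos_of_pos hT _
  have h1 : (r * T ^ (2 / α))⁻¹ * y < T ^ (-(2 / α)) ↔ y < r := by
    rw [Real.rpow_neg hT.le, mul_inv, mul_assoc, inv_mul_lt_iff₀ hr, mul_comm r,
      mul_lt_mul_iff_right₀ (inv_pos.2 hκ)]
  have h2 : T * (r / |y|) ^ (α / 2) = (((r * T ^ (2 / α))⁻¹ * y) ^ (α / 2))⁻¹ := by
    rw [abs_of_pos hy, ← Real.inv_rpow (by positivity), mul_inv, inv_inv, mul_right_comm,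
      Real.mul_rpow (by positivity) hκ.le, ← Real.rpow_mul hT.le,
      show 2 / α * (α / 2) = 1 by field_simp, Real.rpow_one, mul_comm, div_eq_mul_inv]
  have hU : 0 < ((r * T ^ (2 / α))⁻¹ * y) ^ (α / 2) := by positivity
  rw [palmFactor, interferenceFactor, scaledLoss, h2]
  simp only [h1]
  set U := ((r * T ^ (2 / α))⁻¹ * y) ^ (α / 2)
  split_ifs
  · field_simp; ring
  · field_simp; ring

lemma integrableOn_scaledLoss (hα : 2 < α) :
    IntegrableOn (scaledLoss T α q p) (Set.Ioi 0) := by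
  have h1 : scaledLoss T α q p = fun u => q * (1 / (1 + u ^ (α / 2))) +
      (Set.Iio (T ^ (-(2 / α)))).indicator (fun u => p - p * (q * (1 / (1 + u ^ (α / 2))))) u := by
    ext u
    by_cases hu : u < T ^ (-(2 / α))
    · rw [scaledLoss, if_pos hu, Set.indicator_of_mem (by exact hu)]; ring
    · rw [scaledLoss, if_neg hu, Set.indicator_of_notMem (by exact hu), add_zero]
  have hw := (integrableOn_pathLoss hα).const_mul q
  rw [h1]
  refine hw.add ?_
  rw [integrable_indicator_iff measurableSet_Iio, IntegrableOn, Measure.restrict_restrict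
    measurableSet_Iio, Set.Iio_inter_Ioi]
  exact (integrableOn_const (by simp)).sub
    ((hw.mono_measure (Measure.restrict_mono Set.Ioo_subset_Ioi_self le_rfl)).const_mul p)

/-- Below the threshold T^{-2/α} the blocking term p integrates to p after multiplication by
T^{2/α}, and the rest gives (1 - p)qρ₂; above it remains qρ₁. -/
lemma integral_scaledLoss (hT : 0 < T) (hα : 2 < α) :
    T ^ (2 / α) * ∫ u in Set.Ioi 0, scaledLoss T α q p u =
      p + q * (rho1 T α + (1 - p) * rho2 T α) := by
  have hκ : 0 < T ^ (2 / α) := Real.rpow_pos_of_pos hT _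
  have hs : 0 < T ^ (-(2 / α)) := Real.rpow_pos_of_pos hT _
  have hκs : T ^ (2 / α) * T ^ (-(2 / α)) = 1 := by
    rw [← Real.rpow_add hT, add_neg_cancel, Real.rpow_zero]
  have hint := integrableOn_scaledLoss (T := T) (q := q) (p := p) hα
  have hw := integrableOn_pathLoss hα
  have h1 : ∫ u in Set.Ioc 0 (T ^ (-(2 / α))), scaledLoss T α q p u =
      p * T ^ (-(2 / α)) + (1 - p) * q * ∫ u in (0 : ℝ)..(T ^ (-(2 / α))), 1 / (1 + u ^ (α / 2)) := by
    rw [intervalIntegral.integral_of_le hs.le, integral_Ioc_eq_integral_Ioo,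
      integral_Ioc_eq_integral_Ioo, setIntegral_congr_fun measurableSet_Ioo
      (g := fun u => p + (1 - p) * q * (1 / (1 + u ^ (α / 2)))) fun u hu => by
        simp only [scaledLoss, if_pos hu.2]; ring,
      integral_add (integrable_const _)
        (Integrable.const_mul (hw.mono_set Set.Ioo_subset_Ioi_self) _),
      integral_const_mul]
    congr 1
    simp [mul_comm, hs.le]
  have h2 : ∫ u in Set.Ioi (T ^ (-(2 / α))), scaledLoss T α q p u =
      q * ∫ u in Set.Ioi (T ^ (-(2 / α))), 1 / (1 + u ^ (α / 2)) := by
    rw [← integral_const_mul]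
    refine setIntegral_congr_fun measurableSet_Ioi fun u hu => ?_
    simp only [scaledLoss, if_neg (not_lt.2 (le_of_lt (Set.mem_Ioi.1 hu)))]
  rw [← Set.Ioc_union_Ioi_eq_Ioi hs.le, setIntegral_union
    (Set.Ioc_disjoint_Ioi le_rfl) measurableSet_Ioi
    (hint.mono_set Set.Ioc_subset_Ioi_self) (hint.mono_set (Set.Ioi_subset_Ioi hs.le)), h1, h2,
    rho1, rho2]
  linear_combination p * hκs

lemma lintegral_palmExponent (hT : 0 < T) (hα : 2 < α) (hq0 : 0 ≤ q) (hq1 : q ≤ 1) (hp0 : 0 ≤ p)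
    (hp1 : p ≤ 1) {c : ℝ} (hc : 0 < c) (r : ℝ) (hr : 0 ≤ r) :
    ∫⁻ y, (1 - negExp (palmExponent T α q p r y)) ∂(halfLine c) =
      ENNReal.ofReal (c * r * (p + q * (rho1 T α + (1 - p) * rho2 T α))) := by
  have h1 : ∀ y, 1 - negExp (palmExponent T α q p r y) =
      ENNReal.ofReal (1 - palmFactor T α q p r y) := fun y => by
    rw [negExp_palmExponent hT hq0 hq1 hp0 hr, ← ENNReal.ofReal_one, ENNReal.ofReal_sub _ (palmFactor_nonneg hT hq0 hq1 hp1 hr y)]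
  simp_rw [h1]
  rw [halfLine, lintegral_smul_measure, ← restrict_Ioi_eq_restrict_Ici]
  -- At r = 0 the rescaling degenerates, but on positive y nothing blocks or interferes and both
  -- sides vanish.
  rcases hr.eq_or_lt with rfl | hr
  · rw [setLIntegral_congr_fun (g := fun _ => 0) measurableSet_Ioi]
    · simp
    · intro y hy
      have : ¬ y < 0 := not_lt.2 (le_of_lt hy)
      simp [palmFactor, interferenceFactor, this, Real.zero_rpow (by linarith : α / 2 ≠ 0)]
  have hκ : 0 < r * T ^ (2 / α) := mul_pos hr (Real.rpow_pos_of_pos hT _)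
  rw [setLIntegral_congr_fun (g := fun y =>
    ENNReal.ofReal (scaledLoss T α q p ((r * T ^ (2 / α))⁻¹ * y))) measurableSet_Ioi
    fun y hy => by simp only [one_sub_palmFactor hT hα hr hy]]
  rw [← ofReal_integral_eq_lintegral_ofReal, integral_comp_mul_left_Ioi _ _ (inv_pos.2 hκ),
    mul_zero, inv_inv, smul_eq_mul, smul_eq_mul, ← ENNReal.ofReal_mul hc.le,
    ← integral_scaledLoss hT hα]
  · congr 1; ring
  · rw [← IntegrableOn, integrableOn_Ioi_comp_mul_left_iff _ _ (inv_pos.2 hκ), mul_zero]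
    exact integrableOn_scaledLoss hα
  · refine (ae_restrict_iff' measurableSet_Ioi).2 (.of_forall fun y hy => ?_)
    simp only [← one_sub_palmFactor hT hα hr hy, Pi.zero_apply]
    linarith [palmFactor_le_one hT (α := α) hq0 hq1 hp0 hr.le y]

end Factor

/-! ### Integration over independent marks -/

section Product

variable {M : Type*} [MeasurableSpace M] (κ : Measure M) [IsProbabilityMeasure κ]

lemma measurable_update_pair (i : ℕ) :
    Measurable fun z : (ℕ → M) × M => Function.update z.1 i z.2 := by
  refine measurable_pi_lambda _ fun n => ?_
  by_cases hn : n = i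
  · subst hn; simpa using measurable_snd
  · simpa [hn, Function.comp_def] using (measurable_pi_apply n).comp (measurable_fst (β := M))

/-- Redrawing one coordinate independently preserves the product law; this replaces conditioning on
all other coordinates. -/
lemma map_update_infinitePi (i : ℕ) :
    ((Measure.infinitePi fun _ : ℕ => κ).prod κ).map (fun z => Function.update z.1 i z.2) =
      Measure.infinitePi fun _ : ℕ => κ := by
  classical
  have hm := measurable_update_pair (M := M) i
  refine Measure.eq_infinitePi _ fun s t ht => ?_
  rw [Measure.map_apply hm (MeasurableSet.pi s.countable_toSet fun i _ => ht i)]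
  have : (fun z : (ℕ → M) × M => Function.update z.1 i z.2) ⁻¹' Set.pi s t =
      (Set.pi (s.erase i : Finset ℕ) t) ×ˢ (if i ∈ s then t i else Set.univ) := by
    ext ⟨m, a⟩
    simp only [Set.mem_preimage, Set.mem_pi, Finset.mem_coe, Set.mem_prod, Finset.mem_erase]
    constructor
    · intro h
      refine ⟨fun n hn => by simpa [hn.1] using h n hn.2, ?_⟩
      split_ifs with hi
      · simpa using h i hi
      · trivial
    · rintro ⟨h1, h2⟩ n hn
      by_cases hni : n = i
      · subst hni; simpa [hn] using h2
      · simpa [hni] using h1 n ⟨hni, hn⟩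
  rw [this, Measure.prod_prod, Measure.infinitePi_pi _ fun i _ => ht i]
  split_ifs with hi
  · exact Finset.prod_erase_mul s (fun i => κ (t i)) hi
  · simp [Finset.erase_eq_of_notMem hi]

lemma lintegral_resample (i : ℕ) {Φ : (ℕ → M) → ℝ≥0∞} (hΦ : Measurable Φ) :
    ∫⁻ m, Φ m ∂(Measure.infinitePi fun _ : ℕ => κ) =
      ∫⁻ m, ∫⁻ a, Φ (Function.update m i a) ∂κ ∂(Measure.infinitePi fun _ : ℕ => κ) := by
  conv_lhs => rw [← map_update_infinitePi κ i]
  rw [lintegral_map hΦ (measurable_update_pair i)]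
  exact lintegral_prod (fun z : (ℕ → M) × M => Φ (Function.update z.1 i z.2))
    (hΦ.comp (measurable_update_pair i)).aemeasurable

/-- Independence factors the finite products, which are bounded by 1, so dominated convergence
passes to the infinite one. -/
lemma lintegral_negExp_tsum {W : ℕ → M → ℝ≥0∞} (hW : ∀ n, Measurable (W n)) {f : ℕ → ℝ≥0∞}
    (hf : ∀ n, ∫⁻ a, negExp (W n a) ∂κ = negExp (f n)) :
    ∫⁻ m, negExp (∑' n, W n (m n)) ∂(Measure.infinitePi fun _ : ℕ => κ) =
      negExp (∑' n, f n) := by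
  have hmeas : ∀ n, Measurable fun a => negExp (W n a) := fun n => measurable_negExp.comp (hW n)
  have hind : iIndepFun (fun n (m : ℕ → M) => negExp (W n (m n)))
      (Measure.infinitePi fun _ : ℕ => κ) :=
    iIndepFun_infinitePi (P := fun _ : ℕ => κ) (X := fun n a => negExp (W n a))
      (fun n => hmeas n)
  have h1 : ∀ N, ∫⁻ m, ∏ n ∈ Finset.range N, negExp (W n (m n))
      ∂(Measure.infinitePi fun _ : ℕ => κ) = ∏ n ∈ Finset.range N, negExp (f n) := fun N => by
    rw [lintegral_prod_eq_prod_lintegral_of_indepFun _ _ hind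
      fun n => (hmeas n).comp (measurable_pi_apply n)]
    refine Finset.prod_congr rfl fun n _ => ?_
    rw [← hf n]
    exact (measurePreserving_eval_infinitePi (fun _ : ℕ => κ) n).lintegral_comp (hmeas n)
  refine tendsto_nhds_unique ?_ (negExp_tsum_tendsto (f := f))
  simp_rw [← h1]
  refine tendsto_lintegral_of_dominated_convergence (fun _ => 1) (fun N => ?_)
    (fun N => .of_forall fun m => ?_) (by simp) (.of_forall fun m => negExp_tsum_tendsto)
  · exact Finset.measurable_prod _ fun n _ => (hmeas n).comp (measurable_pi_apply n)
  · exact Finset.prod_le_one' fun n _ => negExp_le_one _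

end Product

lemma IndepFun.measure_eq_lintegral {Ω S M : Type*} [MeasurableSpace Ω] [MeasurableSpace S]
    [MeasurableSpace M] {μ : Measure Ω} [IsProbabilityMeasure μ] {X : Ω → S} {Z : Ω → M}
    (hX : Measurable X) (hZ : Measurable Z) (h : IndepFun X Z μ) {A : Set (S × M)}
    (hA : MeasurableSet A) :
    μ {ω | (X ω, Z ω) ∈ A} = ∫⁻ ω, (μ.map Z) {m | (X ω, m) ∈ A} ∂μ := by
  have : IsProbabilityMeasure (μ.map Z) := Measure.isProbabilityMeasure_map hZ.aemeasurable
  have h1 := (indepFun_iff_map_prod_eq_prod_map_map hX.aemeasurable hZ.aemeasurable).1 h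
  have h2 : μ {ω | (X ω, Z ω) ∈ A} = (μ.map fun ω => (X ω, Z ω)) A :=
    (Measure.map_apply (hX.prodMk hZ) hA).symm
  rw [h2, h1, Measure.prod_apply hA, lintegral_map (measurable_measure_prodMk_left hA) hX]
  rfl

/-! ### Exponential fading -/

section Exponential

lemma expMeasure_eq : expMeasure 1 =
    (volume : Measure ℝ).withDensity (exponentialPDF 1) := rfl

instance : IsProbabilityMeasure (expMeasure 1) := isProbabilityMeasure_expMeasure one_pos

lemma expMeasure_Ioi {t : ℝ} (ht : 0 ≤ t) :
    expMeasure 1 (Set.Ioi t) = ENNReal.ofReal (Real.exp (-t)) := by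
  have h := cdf_expMeasure_eq one_pos t
  rw [cdf_eq_real, if_pos ht] at h
  rw [← Set.compl_Iic, prob_compl_eq_one_sub measurableSet_Iic, ← ofReal_measureReal, h,
    ← ENNReal.ofReal_one, ← ENNReal.ofReal_sub]
  · simp
  · simpa using ht

lemma expMeasure_lt_ofReal (s : ℝ≥0∞) :
    expMeasure 1 {h | s < ENNReal.ofReal h} = negExp s := by
  rcases eq_or_ne s ∞ with rfl | hs
  · simp
  · have : {h | s < ENNReal.ofReal h} = Set.Ioi s.toReal := by
      ext h
      exact ENNReal.lt_ofReal_iff_toReal_lt hs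
    rw [this, expMeasure_Ioi ENNReal.toReal_nonneg, ← negExp_ofReal ENNReal.toReal_nonneg,
      ENNReal.ofReal_toReal hs]

/-- Tilting the Exp(1) density by e^{-sh} gives 1/(1+s) times the Exp(1+s) density. -/
lemma lintegral_negExp_expMeasure {s : ℝ} (hs : 0 ≤ s) :
    ∫⁻ h, negExp (ENNReal.ofReal s * ENNReal.ofReal h) ∂(expMeasure 1) =
      ENNReal.ofReal (1 / (1 + s)) := by
  have hm : Measurable fun h => negExp (ENNReal.ofReal s * ENNReal.ofReal h) :=
    measurable_negExp.comp (measurable_const.mul ENNReal.measurable_ofReal)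
  have h1 : ∀ h, exponentialPDF 1 h * negExp (ENNReal.ofReal s * ENNReal.ofReal h) =
      ENNReal.ofReal (1 / (1 + s)) * exponentialPDF (1 + s) h := fun h => by
    rcases lt_or_ge h 0 with hh | hh
    · rw [exponentialPDF_of_neg hh, exponentialPDF_of_neg hh, zero_mul, mul_zero]
    · rw [exponentialPDF_of_nonneg hh, exponentialPDF_of_nonneg hh, ← ENNReal.ofReal_mul hs,
        negExp_ofReal (by positivity), ← ENNReal.ofReal_mul (by positivity),
        ← ENNReal.ofReal_mul (by positivity), mul_assoc, ← Real.exp_add]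
      have h2 : -(1 * h) + -(s * h) = -((1 + s) * h) := by ring
      rw [h2]
      congr 1
      field_simp
  have hpdf : Measurable (exponentialPDF 1) := (measurable_exponentialPDFReal 1).ennreal_ofReal
  rw [expMeasure_eq, lintegral_withDensity_eq_lintegral_mul _ hpdf hm]
  simp only [Pi.mul_apply, h1]
  rw [lintegral_const_mul' _ _ ENNReal.ofReal_ne_top,
    lintegral_exponentialPDF_eq_one (by positivity), mul_one]

end Exponential

/-! ### The law of the marks -/

lemma lintegral_bernoulli {S : Type*} [MeasurableSpace S] [MeasurableSingletonClass S]
    (a b : S) (p : unitInterval)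
    (f : S → ℝ≥0∞) : ∫⁻ x, f x ∂(bernoulliMeasure a b p) =
      ENNReal.ofReal p * f a + ENNReal.ofReal (1 - p) * f b := by
  have h1 : ∀ t : unitInterval, ((unitInterval.toNNReal t : ℝ≥0) : ℝ≥0∞) = ENNReal.ofReal t :=
    fun t => (ENNReal.ofReal_coe_nnreal (p := unitInterval.toNNReal t)).symm
  rw [bernoulliMeasure_def, lintegral_add_measure, lintegral_smul_measure, lintegral_smul_measure,
    lintegral_dirac, lintegral_dirac, ENNReal.smul_def, ENNReal.smul_def, h1, h1,
    unitInterval.coe_symm_eq, smul_eq_mul, smul_eq_mul]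

/-- The marks of a device: cached portion, fading and activity. -/
abbrev Mark : Type := FilePortion × ℝ × Bool

/-- The law of the marks of a device. -/
noncomputable def markLaw (p q : unitInterval) : Measure Mark :=
  (bernoulliMeasure FilePortion.A FilePortion.B p).prod
    ((expMeasure 1).prod (bernoulliMeasure true false q))

instance (p q : unitInterval) : IsProbabilityMeasure (markLaw p q) := by
  unfold markLaw; infer_instance

/-- The joint law of the marks of all devices. -/
noncomputable def marksLaw (p q : unitInterval) : Measure (ℕ → Mark) :=
  Measure.infinitePi fun _ => markLaw p q

instance (p q : unitInterval) : IsProbabilityMeasure (marksLaw p q) := by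
  unfold marksLaw; infer_instance

/-- The probability that a device caches the portion `f`. -/
noncomputable def portionProb (p : unitInterval) : FilePortion → ℝ
  | .A => p
  | .B => 1 - p

lemma portionProb_nonneg (p : unitInterval) (f : FilePortion) : 0 ≤ portionProb p f := by
  cases f
  · exact p.2.1
  · exact sub_nonneg.2 p.2.2

lemma portionProb_le_one (p : unitInterval) (f : FilePortion) : portionProb p f ≤ 1 := by
  cases f
  · exact p.2.2
  · exact sub_le_self _ p.2.1

lemma lintegral_portion (p : unitInterval) (f : FilePortion) (g : FilePortion → ℝ≥0∞)
    (u v : ℝ≥0∞) (hu : g f = u) (hv : ∀ f', f' ≠ f → g f' = v) :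
    ∫⁻ a, g a ∂(bernoulliMeasure FilePortion.A FilePortion.B p) =
      ENNReal.ofReal (portionProb p f) * u + ENNReal.ofReal (1 - portionProb p f) * v := by
  rw [lintegral_bernoulli]
  cases f
  · rw [hu, hv .B (by simp)]; rfl
  · rw [hu, hv .A (by simp), add_comm]
    simp [portionProb]

lemma lintegral_markLaw (p q : unitInterval) {g : Mark → ℝ≥0∞} (hg : Measurable g) :
    ∫⁻ a, g a ∂(markLaw p q) = ∫⁻ f, ∫⁻ h, ∫⁻ t, g (f, h, t) ∂(bernoulliMeasure true false q)
      ∂(expMeasure 1) ∂(bernoulliMeasure FilePortion.A FilePortion.B p) := by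
  rw [markLaw, lintegral_prod _ hg.aemeasurable]
  refine lintegral_congr fun f => ?_
  exact lintegral_prod (fun z => g (f, z)) (hg.comp measurable_prodMk_left).aemeasurable

/-- Device `j` is the closest to the origin among those that cache `f` and it covers the origin. -/
def Covered (α T : ℝ) (x : ℕ → Plane) (m : ℕ → Mark) (f : FilePortion) (j : ℕ) : Prop :=
  IsClosest x {n | (m n).1 = f} 0 j ∧
    ENNReal.ofReal T < SIR α x (fun n => (m n).2.1) (fun n => (m n).2.2) j

/-! ### Measurability of the coverage events -/

section Measurability

variable {Z : Type*} [MeasurableSpace Z]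

lemma measurableSet_isClosest {x : Z → ℕ → Plane} (hx : ∀ n, Measurable fun z => x z n)
    {S : Z → Set ℕ} (hS : ∀ n, MeasurableSet {z | n ∈ S z}) (c : Plane) (j : ℕ) :
    MeasurableSet {z | IsClosest (x z) (S z) c j} := by
  have : {z | IsClosest (x z) (S z) c j} = {z | j ∈ S z} ∩
      ⋂ m, ({z | m ∈ S z}ᶜ ∪ {z | dist (x z j) c ≤ dist (x z m) c}) := by
    ext z
    simp [IsClosest, imp_iff_not_or]
  rw [this]
  refine (hS j).inter (MeasurableSet.iInter fun m => (hS m).compl.union ?_)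
  exact measurableSet_le ((hx j).dist measurable_const) ((hx m).dist measurable_const)

lemma measurable_power (α : ℝ) {x : Z → Plane} (hx : Measurable x) {h : Z → ℝ}
    (hh : Measurable h) : Measurable fun z => power α (x z) (h z) :=
  hh.ennreal_ofReal.mul (hx.enorm.pow_const _)

lemma measurable_SIR (α : ℝ) {x : Z → ℕ → Plane} (hx : ∀ n, Measurable fun z => x z n)
    {h : Z → ℕ → ℝ} (hh : ∀ n, Measurable fun z => h z n) {t : Z → ℕ → Bool}
    (ht : ∀ n, Measurable fun z => t z n) (j : ℕ) :
    Measurable fun z => SIR α (x z) (h z) (t z) j := by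
  refine (measurable_power α (hx j) (hh j)).div (Measurable.tsum fun m => ?_)
  refine Measurable.ite ?_ (measurable_power α (hx m) (hh m)) measurable_const
  by_cases hm : m = j
  · simp [hm]
  · have : {a | m ≠ j ∧ t a m = true} = (fun z => t z m) ⁻¹' {true} := by
      ext z; simp [hm]
    rw [this]
    exact ht m (measurableSet_singleton true)

lemma measurableSet_sir (α T : ℝ) {x : Z → ℕ → Plane} (hx : ∀ n, Measurable fun z => x z n)
    {m : Z → ℕ → Mark} (hm : ∀ n, Measurable fun z => m z n) (j : ℕ) :
    MeasurableSet {z | ENNReal.ofReal T <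
      SIR α (x z) (fun n => (m z n).2.1) (fun n => (m z n).2.2) j} :=
  measurableSet_lt measurable_const
    (measurable_SIR α hx (h := fun z n => (m z n).2.1) (t := fun z n => (m z n).2.2)
      (fun n => (hm n).snd.fst) (fun n => (hm n).snd.snd) j)

lemma measurableSet_covered (α T : ℝ) {x : Z → ℕ → Plane} (hx : ∀ n, Measurable fun z => x z n)
    {m : Z → ℕ → Mark} (hm : ∀ n, Measurable fun z => m z n) (f : FilePortion) (j : ℕ) :
    MeasurableSet {z | Covered α T (x z) (m z) f j} := by
  refine (measurableSet_isClosest hx (S := fun z => {n | (m z n).1 = f}) (fun n => ?_) 0 j).inter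
    (measurableSet_sir α T hx hm j)
  exact (hm n).fst (show MeasurableSet {f} from trivial)

end Measurability

/-! ### Coverage given the locations -/

section Load

open scoped Classical in
/-- The exponent whose `negExp` is the conditional probability, given the mark `a` of device `n`,
that this device does not prevent `j` from covering the origin. -/
noncomputable def load (α T : ℝ) (x : ℕ → Plane) (f : FilePortion) (j n : ℕ) (a : Mark) : ℝ≥0∞ :=
  if n = j then 0 else
    (if a.1 = f ∧ dist (x n) 0 < dist (x j) 0 then ∞ else 0) +
      if a.2.2 = true then ENNReal.ofReal T * ‖x j‖ₑ ^ α * power α (x n) a.2.1 else 0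

variable {α T : ℝ} {x : ℕ → Plane} {f : FilePortion} {j : ℕ}

lemma measurable_load (n : ℕ) : Measurable (load α T x f j n) := by
  classical
  unfold load
  split_ifs with hn
  · exact measurable_const
  refine Measurable.add (Measurable.ite ?_ measurable_const measurable_const)
    (Measurable.ite ?_ ?_ measurable_const)
  · exact MeasurableSet.inter (measurable_fst (show MeasurableSet {f} from trivial))
      (MeasurableSet.const _)
  · exact (measurable_snd.comp measurable_snd) (measurableSet_singleton true)
  · exact measurable_const.mul (measurable_power α measurable_const
      (measurable_fst.comp measurable_snd))

/-- If a closer device caches `f`, the load is ∞ and both sides fail. Otherwise the total load is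
T‖x_j‖^α times the interference, and SIR > T says that the fading of `j` exceeds it. The load does
not involve the mark of `j`. -/
lemma covered_update_iff (hT : 0 < T) (hx : x j ≠ 0) (m : ℕ → Mark) (a : Mark) :
    Covered α T x (Function.update m j a) f j ↔
      a.1 = f ∧ ∑' n, load α T x f j n (m n) < ENNReal.ofReal a.2.1 := by
  have hw0 : ‖x j‖ₑ ^ α ≠ 0 := by
    simp [ENNReal.rpow_eq_zero_iff, hx]
  have hwt : ‖x j‖ₑ ^ α ≠ ∞ := by
    simp [ENNReal.rpow_eq_top_iff, hx]
  have hclosest : IsClosest x {n | (Function.update m j a n).1 = f} 0 j ↔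
      a.1 = f ∧ ∀ n, n ≠ j → (m n).1 = f → dist (x j) 0 ≤ dist (x n) 0 := by
    simp only [IsClosest, Set.mem_ofPred_eq, Function.update_self]
    refine and_congr_right fun ha => ⟨fun h n hn hf => h n (by simpa [hn] using hf), fun h n hf => ?_⟩
    by_cases hn : n = j
    · rw [hn]
    · exact h n hn (by simpa [hn] using hf)
  rw [Covered, hclosest, and_assoc]
  refine and_congr_right fun ha => ?_
  by_cases hP : ∀ n, n ≠ j → (m n).1 = f → dist (x j) 0 ≤ dist (x n) 0
  · have hI : ∑' n, load α T x f j n (m n) = ENNReal.ofReal T * ‖x j‖ₑ ^ α *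
        ∑' n, if n ≠ j ∧ (m n).2.2 = true then power α (x n) (m n).2.1 else 0 := by
      rw [← ENNReal.tsum_mul_left]
      refine tsum_congr fun n => ?_
      unfold load
      by_cases hn : n = j
      · simp [hn]
      · have : ¬ ((m n).1 = f ∧ dist (x n) 0 < dist (x j) 0) := fun h =>
          absurd h.2 (not_lt.2 (hP n hn h.1))
        rw [if_neg hn, if_neg this, zero_add]
        by_cases ht : (m n).2.2 = true
        · simp [hn, ht]
        · simp [ht]
    have hS : SIR α x (fun n => (Function.update m j a n).2.1)
        (fun n => (Function.update m j a n).2.2) j = power α (x j) a.2.1 /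
        ∑' n, if n ≠ j ∧ (m n).2.2 = true then power α (x n) (m n).2.1 else 0 := by
      unfold SIR
      congr 1
      · simp
      · refine tsum_congr fun n => ?_
        by_cases hn : n = j
        · simp [hn]
        · simp [hn]
    rw [hS, hI]
    set I := ∑' n, if n ≠ j ∧ (m n).2.2 = true then power α (x n) (m n).2.1 else 0
    -- The interference `I` may be 0 or ∞; 0 < T < ∞ keeps the equivalence valid in both cases.
    rw [ENNReal.lt_div_iff_mul_lt (Or.inr ENNReal.ofReal_ne_top)
      (Or.inr (by simpa using hT)), power, ENNReal.rpow_neg, ← div_eq_mul_inv,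
      ENNReal.lt_div_iff_mul_lt (Or.inl hw0) (Or.inl hwt), mul_right_comm]
    exact ⟨fun h => h.2, fun h => ⟨hP, h⟩⟩
  · push Not at hP
    obtain ⟨n, hn, hf, hlt⟩ := hP
    have h1 : load α T x f j n (m n) = ∞ := by
      rw [load, if_neg hn, if_pos ⟨hf, hlt⟩, top_add]
    have h2 : ∑' n, load α T x f j n (m n) = ∞ := ENNReal.tsum_eq_top_of_eq_top ⟨n, h1⟩
    rw [h2]
    exact ⟨fun h => absurd (h.1 n hn hf) (not_le.2 hlt), fun h => absurd h not_top_lt⟩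

variable {p q : unitInterval}

omit f j in
lemma interference_eq (hT : 0 < T) {u v : Plane} (hu : u ≠ 0) (hv : v ≠ 0) (h : ℝ) :
    ENNReal.ofReal T * ‖u‖ₑ ^ α * power α v h =
      ENNReal.ofReal (T * (dist u 0 ^ 2 / |dist v 0 ^ 2|) ^ (α / 2)) * ENNReal.ofReal h := by
  have hu' : 0 < ‖u‖ := norm_pos_iff.2 hu
  have hv' : 0 < ‖v‖ := norm_pos_iff.2 hv
  have h1 : (dist u 0 ^ 2 / |dist v 0 ^ 2|) ^ (α / 2) = ‖u‖ ^ α * ‖v‖ ^ (-α) := by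
    rw [dist_zero_right, dist_zero_right, abs_of_nonneg (by positivity), ← div_pow,
      ← Real.rpow_natCast, ← Real.rpow_mul (by positivity), Real.div_rpow hu'.le hv'.le]
    have : ((2 : ℕ) : ℝ) * (α / 2) = α := by push_cast; ring
    rw [this, Real.rpow_neg hv'.le, div_eq_mul_inv]
  rw [h1, power, ENNReal.ofReal_mul hT.le, ENNReal.ofReal_mul (by positivity),
    ← ENNReal.ofReal_rpow_of_pos hu', ← ENNReal.ofReal_rpow_of_pos hv', ofReal_norm, ofReal_norm]
  ring

/-- The portion contributes 1 - p when device `n` is closer than `j`; activity and fading contribute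
1 - q + q/(1+s), by the Laplace transform of Exp(1). -/
lemma lintegral_negExp_load (hT : 0 < T) (hx : ∀ n, x n ≠ 0) (n : ℕ) :
    ∫⁻ a, negExp (load α T x f j n a) ∂(markLaw p q) = negExp (if n = j then 0 else
      palmExponent T α q (portionProb p f) (dist (x j) 0 ^ 2) (dist (x n) 0 ^ 2)) := by
  classical
  by_cases hn : n = j
  · simp [load, hn]
  rw [if_neg hn, negExp_palmExponent hT q.2.1 q.2.2 (portionProb_nonneg p f) (sq_nonneg _),
    lintegral_markLaw p q (g := fun a => negExp (load α T x f j n a))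
      (measurable_negExp.comp (measurable_load n))]
  set s := T * (dist (x j) 0 ^ 2 / |dist (x n) 0 ^ 2|) ^ (α / 2) with hs
  have hs0 : 0 ≤ s := by positivity
  have hinner : ∫⁻ h, ∫⁻ t, negExp (if t = true then
      ENNReal.ofReal T * ‖x j‖ₑ ^ α * power α (x n) h else 0) ∂(bernoulliMeasure true false q)
      ∂(expMeasure 1) =
      ENNReal.ofReal (interferenceFactor T α q (dist (x j) 0 ^ 2) (dist (x n) 0 ^ 2)) := by
    have hm : Measurable fun h => negExp (ENNReal.ofReal s * ENNReal.ofReal h) :=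
      measurable_negExp.comp (measurable_const.mul ENNReal.measurable_ofReal)
    simp_rw [lintegral_bernoulli, interference_eq hT (hx j) (hx n)]
    simp only [if_true, Bool.false_eq_true, if_false, negExp_zero, mul_one]
    rw [lintegral_add_right _ measurable_const, lintegral_const_mul _ hm,
      lintegral_negExp_expMeasure hs0, lintegral_const, measure_univ, mul_one,
      ← ENNReal.ofReal_mul q.2.1, ← ENNReal.ofReal_add
      (mul_nonneg q.2.1 (by positivity)) (sub_nonneg.2 q.2.2), interferenceFactor, ← hs]
    congr 1
    ring
  have hlt : dist (x n) 0 ^ 2 < dist (x j) 0 ^ 2 ↔ dist (x n) 0 < dist (x j) 0 :=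
    pow_lt_pow_iff_left₀ dist_nonneg dist_nonneg two_ne_zero
  have hgood : ∀ f', ¬ (f' = f ∧ dist (x n) 0 < dist (x j) 0) →
      ∫⁻ h, ∫⁻ t, negExp (load α T x f j n (f', h, t)) ∂(bernoulliMeasure true false q)
        ∂(expMeasure 1) =
      ENNReal.ofReal (interferenceFactor T α q (dist (x j) 0 ^ 2) (dist (x n) 0 ^ 2)) :=
    fun f' hf' => by
      rw [← hinner]
      refine lintegral_congr fun h => lintegral_congr fun t => ?_
      rw [load, if_neg hn, if_neg hf', zero_add]
  have hbad : dist (x n) 0 < dist (x j) 0 → ∫⁻ h, ∫⁻ t, negExp (load α T x f j n (f, h, t))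
      ∂(bernoulliMeasure true false q) ∂(expMeasure 1) = 0 := fun hd => by
    have : ∀ h t, load α T x f j n (f, h, t) = ∞ := fun h t => by
      rw [load, if_neg hn, if_pos ⟨rfl, hd⟩, top_add]
    simp [this]
  by_cases hd : dist (x n) 0 < dist (x j) 0
  · rw [lintegral_portion p f _ _ _ (hbad hd) fun f' hf' => hgood f' fun h => hf' h.1, mul_zero,
      zero_add, palmFactor, if_pos (hlt.2 hd),
      ENNReal.ofReal_mul (sub_nonneg.2 (portionProb_le_one p f))]
  · simp_rw [hgood _ fun h => hd h.2]
    rw [lintegral_const, measure_univ, mul_one, palmFactor, if_neg (mt hlt.1 hd), one_mul]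

/-- Redraw the mark of `j`: it caches `f` with probability p_f, and its fading exceeds the total
load s with probability e^{-s}. The remaining mean factors over the other devices. -/
lemma marksLaw_covered (hT : 0 < T) (hx : ∀ n, x n ≠ 0) :
    marksLaw p q {m | Covered α T x m f j} = ENNReal.ofReal (portionProb p f) *
      palmProd (palmExponent T α q (portionProb p f)) (fun n => dist (x n) 0 ^ 2) j := by
  have hms : MeasurableSet {m | Covered α T x m f j} :=
    measurableSet_covered α T (x := fun _ => x) (fun _ => measurable_const)
      (m := fun m => m) (fun n => measurable_pi_apply n) f j
  rw [← lintegral_indicator_one hms, marksLaw, lintegral_resample _ j (measurable_one.indicator hms)]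
  have hupd : ∀ m : ℕ → Mark, Measurable fun a => Function.update m j a := fun m =>
    (measurable_update_pair j).comp measurable_prodMk_left
  have hin : ∀ m : ℕ → Mark, ∫⁻ a, {m | Covered α T x m f j}.indicator 1 (Function.update m j a)
      ∂(markLaw p q) = ENNReal.ofReal (portionProb p f) *
      negExp (∑' n, load α T x f j n (m n)) := fun m => by
    rw [lintegral_markLaw p q
      (g := fun a => {m | Covered α T x m f j}.indicator 1 (Function.update m j a))
      ((measurable_one.indicator hms).comp (hupd m)),
      lintegral_portion p f _ (negExp (∑' n, load α T x f j n (m n))) 0, mul_zero, add_zero]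
    · rw [← expMeasure_lt_ofReal, ← lintegral_indicator_one (measurableSet_lt measurable_const
        ENNReal.measurable_ofReal)]
      refine lintegral_congr fun h => ?_
      have : ∀ t, {m | Covered α T x m f j}.indicator (1 : (ℕ → Mark) → ℝ≥0∞)
          (Function.update m j (f, h, t)) =
          {h | ∑' n, load α T x f j n (m n) < ENNReal.ofReal h}.indicator 1 h := fun t => by
        refine Set.indicator_eq_indicator ?_ rfl
        exact (covered_update_iff hT (hx j) m (f, h, t)).trans (and_iff_right rfl)
      simp_rw [this]
      simp
    · intro f' hf'
      have : ∀ h t, {m | Covered α T x m f j}.indicator (1 : (ℕ → Mark) → ℝ≥0∞)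
          (Function.update m j (f', h, t)) = 0 := fun h t =>
        Set.indicator_of_notMem (s := {m | Covered α T x m f j}) (fun hc =>
          hf' ((covered_update_iff hT (hx j) m (f', h, t)).1 hc).1) _
      simp [this]
  simp_rw [hin]
  rw [lintegral_const_mul' _ _ ENNReal.ofReal_ne_top, lintegral_negExp_tsum (markLaw p q)
    (fun n => measurable_load n) (fun n => lintegral_negExp_load hT hx n)]
  rfl

end Load

/-! ### Separating the portion of one device -/

lemma marksLaw_portion_inter {p q : unitInterval} (i : ℕ) (f : FilePortion)
    {B : Set (ℕ → Mark)} (hB : MeasurableSet B)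
    (hinv : ∀ m f₁ f₂ c, Function.update m i (f₁, c) ∈ B → Function.update m i (f₂, c) ∈ B) :
    marksLaw p q {m | (m i).1 = f ∧ m ∈ B} =
      ENNReal.ofReal (portionProb p f) * marksLaw p q B := by
  have hmf : MeasurableSet {m : ℕ → Mark | (m i).1 = f} :=
    (measurable_pi_apply i).fst (show MeasurableSet {f} from trivial)
  have hA : MeasurableSet {m : ℕ → Mark | (m i).1 = f ∧ m ∈ B} := hmf.inter hB
  have hupd : ∀ m : ℕ → Mark, Measurable fun a => Function.update m i a := fun m =>
    (measurable_update_pair i).comp measurable_prodMk_left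
  rw [← lintegral_indicator_one hA, ← lintegral_indicator_one hB, marksLaw,
    lintegral_resample _ i (measurable_one.indicator hA),
    lintegral_resample _ i (measurable_one.indicator hB),
    ← lintegral_const_mul' _ _ ENNReal.ofReal_ne_top]
  refine lintegral_congr fun m => ?_
  set c := ∫⁻ h, ∫⁻ t, B.indicator (1 : (ℕ → Mark) → ℝ≥0∞) (Function.update m i (f, h, t))
    ∂(bernoulliMeasure true false q) ∂(expMeasure 1)
  have hc : ∀ f', ∫⁻ h, ∫⁻ t, B.indicator (1 : (ℕ → Mark) → ℝ≥0∞)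
      (Function.update m i (f', h, t)) ∂(bernoulliMeasure true false q) ∂(expMeasure 1) = c :=
    fun f' => lintegral_congr fun h => lintegral_congr fun t =>
      Set.indicator_eq_indicator ⟨hinv _ _ _ _, hinv _ _ _ _⟩ rfl
  rw [lintegral_markLaw p q (g := fun a => B.indicator 1 (Function.update m i a))
      ((measurable_one.indicator hB).comp (hupd m)),
    lintegral_markLaw p q
      (g := fun a => {m : ℕ → Mark | (m i).1 = f ∧ m ∈ B}.indicator 1 (Function.update m i a))
      ((measurable_one.indicator hA).comp (hupd m))]
  simp_rw [hc]
  rw [lintegral_const, measure_univ, mul_one, lintegral_portion p f _ c 0, mul_zero, add_zero]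
  · refine lintegral_congr fun h => lintegral_congr fun t => ?_
    refine Set.indicator_eq_indicator ⟨fun h => h.2, fun h => ⟨?_, h⟩⟩ rfl
    simp
  · intro f' hf'
    have : ∀ h t, {m : ℕ → Mark | (m i).1 = f ∧ m ∈ B}.indicator (1 : (ℕ → Mark) → ℝ≥0∞)
        (Function.update m i (f', h, t)) = 0 := fun h t =>
      Set.indicator_of_notMem (s := {m : ℕ → Mark | (m i).1 = f ∧ m ∈ B})
        (fun hm => hf' (by simpa using hm.1)) _
    simp [this]

/-- Device `j` covers the origin and is the closest to it among the devices other than `i` that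
cache `f`. -/
def CoveredExcept (α T : ℝ) (x : ℕ → Plane) (m : ℕ → Mark) (f : FilePortion) (i j : ℕ) : Prop :=
  IsClosest x {n | n ≠ i ∧ (m n).1 = f} 0 j ∧
    ENNReal.ofReal T < SIR α x (fun n => (m n).2.1) (fun n => (m n).2.2) j

lemma measurableSet_coveredExcept {Z : Type*} [MeasurableSpace Z] (α T : ℝ) {x : Z → ℕ → Plane}
    (hx : ∀ n, Measurable fun z => x z n)
    {m : Z → ℕ → Mark} (hm : ∀ n, Measurable fun z => m z n) (f : FilePortion) (i j : ℕ) :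
    MeasurableSet {z | CoveredExcept α T (x z) (m z) f i j} := by
  refine (measurableSet_isClosest hx (S := fun z => {n | n ≠ i ∧ (m z n).1 = f})
    (fun n => ?_) 0 j).inter (measurableSet_sir α T hx hm j)
  exact (MeasurableSet.const (n ≠ i)).inter ((hm n).fst (show MeasurableSet {f} from trivial))

lemma measurableSet_exists_covered {Z : Type*} [MeasurableSpace Z] (α T : ℝ) {x : Z → ℕ → Plane}
    (hx : ∀ n, Measurable fun z => x z n)
    {m : Z → ℕ → Mark} (hm : ∀ n, Measurable fun z => m z n) (f : FilePortion) :
    MeasurableSet {z | ∃ j, Covered α T (x z) (m z) f j} := by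
  simp only [Set.ofPred_exists]
  exact MeasurableSet.iUnion fun j => measurableSet_covered α T hx hm f j

lemma measurableSet_exists_coveredExcept {Z : Type*} [MeasurableSpace Z] (α T : ℝ)
    {x : Z → ℕ → Plane} (hx : ∀ n, Measurable fun z => x z n)
    {m : Z → ℕ → Mark} (hm : ∀ n, Measurable fun z => m z n) (f : FilePortion) (i : ℕ) :
    MeasurableSet {z | ∃ j, CoveredExcept α T (x z) (m z) f i j} := by
  simp only [Set.ofPred_exists]
  exact MeasurableSet.iUnion fun j => measurableSet_coveredExcept α T hx hm f i j

lemma coveredExcept_update {α T : ℝ} {x : ℕ → Plane} {m : ℕ → Mark} {f : FilePortion} {i j : ℕ}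
    {f₁ f₂ : FilePortion} {c : ℝ × Bool}
    (h : CoveredExcept α T x (Function.update m i (f₁, c)) f i j) :
    CoveredExcept α T x (Function.update m i (f₂, c)) f i j := by
  have h1 : ∀ n, (Function.update m i (f₁, c) n).2 = (Function.update m i (f₂, c) n).2 :=
    fun n => by by_cases hn : n = i <;> simp [hn]
  have h2 : {n | n ≠ i ∧ (Function.update m i (f₁, c) n).1 = f} =
      {n | n ≠ i ∧ (Function.update m i (f₂, c) n).1 = f} := by
    ext n
    by_cases hn : n = i <;> simp [hn]
  simpa only [CoveredExcept, h1, h2] using h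

lemma coveredExcept_iff_covered {α T : ℝ} {x : ℕ → Plane} {m : ℕ → Mark} {f : FilePortion}
    {i j : ℕ} (hi : (m i).1 ≠ f) : CoveredExcept α T x m f i j ↔ Covered α T x m f j := by
  have : {n | n ≠ i ∧ (m n).1 = f} = {n | (m n).1 = f} := by
    ext n
    simp only [Set.mem_ofPred_eq, and_iff_right_iff_imp]
    rintro h rfl
    exact hi h
  rw [CoveredExcept, Covered, this]

/-- Striking out `i` matters only if `i` is the winner; the interference is the same on both sides.
-/
lemma exists_coveredExcept_iff {α T : ℝ} {x : ℕ → Plane} {m : ℕ → Mark} {f : FilePortion}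
    {i : ℕ} (hi : ¬ IsClosest x {n | (m n).1 = f} 0 i) :
    (∃ j, CoveredExcept α T x m f i j) ↔ ∃ j, Covered α T x m f j := by
  constructor
  · rintro ⟨j, ⟨⟨-, hj⟩, hmin⟩, hs⟩
    refine ⟨j, ⟨hj, fun n hn => ?_⟩, hs⟩
    by_cases hni : n = i
    · subst hni
      by_contra hlt
      -- A device `i` strictly closer than the winner among the others would be the overall winner,
      -- which `hi` excludes.
      refine hi ⟨hn, fun k hk => ?_⟩
      by_cases hkn : k = n
      · rw [hkn]
      · exact (not_le.1 hlt).le.trans (hmin k ⟨hkn, hk⟩)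
    · exact hmin n ⟨hni, hn⟩
  · rintro ⟨j, hj, hs⟩
    refine ⟨j, ⟨⟨?_, hj.1⟩, fun n hn => hj.2 n hn.2⟩, hs⟩
    rintro rfl
    exact hi hj

lemma rho1_nonneg {T α : ℝ} (hT : 0 < T) : 0 ≤ rho1 T α := by
  have hs := Real.rpow_pos_of_pos hT (-(2 / α))
  refine mul_nonneg (Real.rpow_nonneg hT.le _) (setIntegral_nonneg measurableSet_Ioi fun u hu => ?_)
  have := Real.rpow_pos_of_pos (hs.trans hu) (α / 2)
  positivity

lemma rho2_nonneg {T α : ℝ} (hT : 0 < T) : 0 ≤ rho2 T α := by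
  have hs := Real.rpow_pos_of_pos hT (-(2 / α))
  refine mul_nonneg (Real.rpow_nonneg hT.le _)
    (intervalIntegral.integral_nonneg hs.le fun u hu => ?_)
  have := Real.rpow_nonneg hu.1 (α / 2)
  positivity

/-! ### Coverage in the independent scenario -/

section Network

variable {Ω : Type*} [MeasurableSpace Ω] {μ : Measure Ω} {lam : ℝ} {p q : unitInterval}
  {α T : ℝ} {X : ℕ → Ω → Plane} {file : ℕ → Ω → FilePortion} {fading : ℕ → Ω → ℝ}
  {active : ℕ → Ω → Bool}

/-- The sequence of marks. -/
def marks (file : ℕ → Ω → FilePortion) (fading : ℕ → Ω → ℝ) (active : ℕ → Ω → Bool) (ω : Ω) :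
    ℕ → Mark := fun n => (file n ω, fading n ω, active n ω)

variable (hnet : IsNetwork μ lam p q X file fading active)
include hnet

lemma IsNetwork.measurable_locations : Measurable fun ω n => X n ω :=
  measurable_pi_lambda _ hnet.measurable_location

lemma IsNetwork.measurable_marks : Measurable (marks file fading active) :=
  measurable_pi_lambda _ fun n => (hnet.measurable_file n).prodMk
    ((hnet.measurable_fading n).prodMk (hnet.measurable_active n))

lemma IsNetwork.map_marks : μ.map (marks file fading active) = marksLaw p q :=
  (hnet.mark_indep.hasLaw_infinitePi hnet.mark_law hnet.measurable_marks.aemeasurable).map_eq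

variable [IsProbabilityMeasure μ]

lemma IsNetwork.measure_eq_lintegral {A : Set ((ℕ → Plane) × (ℕ → Mark))}
    (hA : MeasurableSet A) :
    μ {ω | ((fun n => X n ω), marks file fading active ω) ∈ A} =
      ∫⁻ ω, marksLaw p q {m | ((fun n => X n ω), m) ∈ A} ∂μ := by
  rw [← hnet.map_marks]
  exact IndepFun.measure_eq_lintegral hnet.measurable_locations hnet.measurable_marks
    hnet.location_indep_mark hA

variable (hlam : 0 < lam)
include hlam

lemma IsNetwork.ae_dist_injective (z : Plane) :
    ∀ᵐ ω ∂μ, Function.Injective fun n => dist (X n ω) z := by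
  filter_upwards [ae_injective (isPoissonProcess_dist_sq hlam.le hnet.poisson z)
    fun n => ((hnet.measurable_location n).dist measurable_const).pow_const 2] with ω hω m n h
  exact hω (congrArg (· ^ 2) h)

lemma IsNetwork.ae_ne_zero : ∀ᵐ ω ∂μ, ∀ n, X n ω ≠ 0 := by
  filter_upwards [ae_pos (isPoissonProcess_dist_sq hlam.le hnet.poisson 0)
    fun n => ((hnet.measurable_location n).dist measurable_const).pow_const 2] with ω hω n h
  simpa [h] using hω n

omit [IsProbabilityMeasure μ] in
-- Devices no farther from `z` than device 0 lie in a disc about the origin, which holds finitely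
-- many. Using discs about the origin for all `z` gives one null set valid for every `z`.
lemma IsNetwork.ae_exists_isClosest :
    ∀ᵐ ω ∂μ, ∀ z, ∃ i, IsClosest (fun n => X n ω) Set.univ z i := by
  filter_upwards [ae_finite_le (isPoissonProcess_dist_sq hlam.le hnet.poisson 0)] with ω hω z
  have h : {n | dist (X n ω) z ≤ dist (X 0 ω) z}.Finite := by
    refine (hω ((dist (X 0 ω) z + dist z 0) ^ 2)).subset fun n hn => ?_
    have hn' : dist (X n ω) z ≤ dist (X 0 ω) z := hn
    refine pow_le_pow_left₀ dist_nonneg ((dist_triangle _ z 0).trans ?_) 2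
    gcongr
  obtain ⟨i, hi, hmin⟩ := Set.exists_min_image _ (fun n => dist (X n ω) z) h
    ⟨0, show dist (X 0 ω) z ≤ dist (X 0 ω) z from le_rfl⟩
  refine ⟨i, trivial, fun m _ => ?_⟩
  rcases le_total (dist (X m ω) z) (dist (X 0 ω) z) with hm | hm
  · exact hmin m hm
  · exact (show dist (X i ω) z ≤ dist (X 0 ω) z from hi).trans hm

/-- Distances are almost surely distinct, so at most one device serves and the events for different
`j` are disjoint. Their conditional probabilities sum to p_f times the sum whose mean is 1/K. -/
lemma IsNetwork.measure_covered (hT : 0 < T) (hα : 2 < α) (f : FilePortion)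
    (hf : 0 < portionProb p f) :
    μ {ω | ∃ j, Covered α T (fun n => X n ω) (marks file fading active ω) f j} =
      ENNReal.ofReal (Pc T α q (portionProb p f)) := by
  have hA : MeasurableSet {z : (ℕ → Plane) × (ℕ → Mark) | ∃ j, Covered α T z.1 z.2 f j} :=
    measurableSet_exists_covered α T
      (fun n => (measurable_pi_apply n).comp measurable_fst)
      (fun n => (measurable_pi_apply n).comp measurable_snd) f
  have h1 := hnet.measure_eq_lintegral hA
  have h2 : ∀ᵐ ω ∂μ, marksLaw p q {m | ∃ j, Covered α T (fun n => X n ω) m f j} =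
      ENNReal.ofReal (portionProb p f) * ∑' j, palmProd (palmExponent T α q (portionProb p f))
        (fun n => dist (X n ω) 0 ^ 2) j := by
    filter_upwards [hnet.ae_dist_injective hlam 0, hnet.ae_ne_zero hlam] with ω hinj h0
    rw [← ENNReal.tsum_mul_left, Set.ofPred_exists, measure_iUnion]
    · exact tsum_congr fun j => marksLaw_covered hT h0
    · intro j k hjk
      refine Set.disjoint_left.2 fun m hj hk => hjk (hinj ?_)
      exact le_antisymm (hj.1.2 k hk.1.1) (hk.1.2 j hj.1.1)
    · exact fun j => measurableSet_covered α T (x := fun _ n => X n ω) (fun n => measurable_const)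
        (m := fun m => m) (fun n => measurable_pi_apply n) f j
  have hK : 0 < portionProb p f +
      q * (rho1 T α + (1 - portionProb p f) * rho2 T α) := by
    have := mul_nonneg (sub_nonneg.2 (portionProb_le_one p f)) (rho2_nonneg (α := α) hT)
    have := mul_nonneg q.2.1 (add_nonneg (rho1_nonneg (α := α) hT) this)
    linarith
  have hc : 0 < lam * Real.pi := mul_pos hlam Real.pi_pos
  refine h1.trans ?_
  refine (lintegral_congr_ae h2).trans ?_
  rw [lintegral_const_mul' _ _ ENNReal.ofReal_ne_top, lintegral_tsum_palmProd
    (K := portionProb p f + q * (rho1 T α + (1 - portionProb p f) * rho2 T α)) hc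
    (isPoissonProcess_dist_sq hlam.le hnet.poisson 0)
    (fun n => ((hnet.measurable_location n).dist measurable_const).pow_const 2)
    measurable_palmExponent
    (palmExponent_mono hT (by linarith) q.2.1 q.2.2 hf.le (portionProb_le_one p f)) hK
    (lintegral_palmExponent hT hα q.2.1 q.2.2 hf.le (portionProb_le_one p f) hc),
    ← ENNReal.ofReal_mul hf.le, Pc, mul_one_div]

lemma IsNetwork.coverageIndep_eq (hT : 0 < T) (hα : 2 < α) (f : FilePortion)
    (hf : 0 < portionProb p f) :
    coverageIndep μ X file fading active α T f = Pc T α q (portionProb p f) := by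
  have h := hnet.measure_covered hlam hT hα f hf
  have h0 : 0 ≤ Pc T α q (portionProb p f) := by
    have := mul_nonneg (sub_nonneg.2 (portionProb_le_one p f)) (rho2_nonneg (α := α) hT)
    have := mul_nonneg q.2.1 (add_nonneg (rho1_nonneg (α := α) hT) this)
    exact div_nonneg hf.le (by linarith)
  calc coverageIndep μ X file fading active α T f
      = (ENNReal.ofReal (Pc T α q (portionProb p f))).toReal := congrArg ENNReal.toReal h
    _ = _ := ENNReal.toReal_ofReal h0

end Network

/-! ### The limit of distant locations -/

/-- A point further to the left is eventually closer to location 1. -/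
lemma eventually_dist_location1_lt {a b : Plane} (h : a 0 < b 0) :
    ∀ᶠ v in atTop, dist a (location1 v) < dist b (location1 v) := by
  -- The squared distances of `a` and `b` to (-v, 0) differ by ‖a‖² - ‖b‖² - 2v(b₀ - a₀), which is
  -- negative beyond this threshold.
  filter_upwards [eventually_gt_atTop
    ((a 0 ^ 2 + a 1 ^ 2 - b 0 ^ 2 - b 1 ^ 2) / (2 * (b 0 - a 0)))] with v hv
  rw [div_lt_iff₀ (by linarith)] at hv
  rw [EuclideanSpace.dist_eq, EuclideanSpace.dist_eq]
  refine Real.sqrt_lt_sqrt (by positivity) ?_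
  simp only [Fin.sum_univ_two, Real.dist_eq, sq_abs, location1, PiLp.toLp_apply,
    Matrix.cons_val_zero, Matrix.cons_val_one]
  nlinarith

/-- The portion other than `f`. -/
def FilePortion.other : FilePortion → FilePortion
  | .A => .B
  | .B => .A

lemma FilePortion.ne_iff_eq_other {f g : FilePortion} : f ≠ g ↔ f = g.other := by
  cases f <;> cases g <;> simp [FilePortion.other]

lemma FilePortion.eq_A_or_eq_B (f : FilePortion) : f = .A ∨ f = .B := by
  cases f <;> simp

section Network

variable {Ω : Type*} [MeasurableSpace Ω] {μ : Measure Ω} {lam : ℝ} {p q : unitInterval}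
  {α T : ℝ} {X : ℕ → Ω → Plane} {file : ℕ → Ω → FilePortion} {fading : ℕ → Ω → ℝ}
  {active : ℕ → Ω → Bool} [IsProbabilityMeasure μ]
  (hnet : IsNetwork μ lam p q X file fading active) (hlam : 0 < lam)
include hnet hlam

/-- The half-plane left of -k contains discs of every radius N, and such a disc is empty with
probability exp(-λπN²). -/
lemma IsNetwork.ae_exists_lt : ∀ᵐ ω ∂μ, ∀ b : ℝ, ∃ n, X n ω 0 < b := by
  have h : ∀ k : ℕ, ∀ᵐ ω ∂μ, ∃ n, X n ω 0 < -(k : ℝ) := by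
    intro k
    have hb : ∀ N : ℕ, μ {ω | ¬ ∃ n, X n ω 0 < -(k : ℝ)} ≤
        ENNReal.ofReal (Real.exp (-(lam * Real.pi * (N : ℝ) ^ 2))) := by
      intro N
      let z : Plane := !₂[-((k : ℝ) + N), 0]
      have hsub : {ω | ¬ ∃ n, X n ω 0 < -(k : ℝ)} ⊆ {ω | ∀ n, X n ω ∉ Metric.ball z N} := by
        intro ω hω n hn
        refine hω ⟨n, ?_⟩
        have h1 := PiLp.norm_apply_le (X n ω - z) 0
        have h2 : ‖X n ω - z‖ < N := by rwa [← dist_eq_norm]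
        have h3 : |X n ω 0 - -((k : ℝ) + N)| < N := lt_of_le_of_lt (by simpa [z] using h1) h2
        linarith [(abs_lt.1 h3).2]
      refine (measure_mono hsub).trans (le_of_eq ?_)
      have hσ : SigmaFinite (ENNReal.ofReal lam • (volume : Measure Plane)) :=
        inferInstanceAs (SigmaFinite (lam.toNNReal • (volume : Measure Plane)))
      have hP : IsPoissonProcess (ENNReal.ofReal lam • (volume : Measure Plane))
        (countPoints X) μ := hnet.poisson
      rw [hP.measure_void hnet.measurable_location measurableSet_ball, Measure.smul_apply,
        EuclideanSpace.volume_ball_fin_two, smul_eq_mul, ← ENNReal.ofReal_pow (by positivity),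
        ← negExp_ofReal (by positivity), ENNReal.ofReal_mul (by positivity),
        ENNReal.ofReal_mul hlam.le]
      congr 1
      ring
    have hlim : Tendsto (fun N : ℕ => ENNReal.ofReal (Real.exp (-(lam * Real.pi * (N : ℝ) ^ 2))))
        atTop (𝓝 0) := by
      rw [← ENNReal.ofReal_zero]
      refine ENNReal.tendsto_ofReal (Real.tendsto_exp_neg_atTop_nhds_zero.comp ?_)
      exact ((tendsto_pow_atTop two_ne_zero).comp tendsto_natCast_atTop_atTop).const_mul_atTop
        (mul_pos hlam Real.pi_pos)
    exact le_antisymm (ge_of_tendsto' hlim hb) zero_le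
  filter_upwards [ae_all_iff.2 h] with ω hω b
  obtain ⟨k, hk⟩ := exists_nat_ge (-b)
  obtain ⟨n, hn⟩ := hω k
  exact ⟨n, by linarith⟩

omit hlam [IsProbabilityMeasure μ] in
lemma IsNetwork.measurableSet_closest_univ (z : Plane) (i : ℕ) :
    MeasurableSet {ω | IsClosest (fun n => X n ω) Set.univ z i} :=
  measurableSet_isClosest (fun n => hnet.measurable_location n)
    (fun _ => MeasurableSet.univ) z i

/-- The portion of the device closest to `z` is independent of the coverage by the other devices. -/
lemma IsNetwork.measure_closest_covered (z : Plane) {f g : FilePortion} (hfg : g ≠ f) :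
    μ {ω | ∃ i, IsClosest (fun n => X n ω) Set.univ z i ∧ file i ω = g ∧
      ∃ j, Covered α T (fun n => X n ω) (marks file fading active ω) f j} =
    ENNReal.ofReal (portionProb p g) *
      μ {ω | ∃ i, IsClosest (fun n => X n ω) Set.univ z i ∧
        ∃ j, CoveredExcept α T (fun n => X n ω) (marks file fading active ω) f i j} := by
  have hx : ∀ n, Measurable fun y : (ℕ → Plane) × (ℕ → Mark) => y.1 n := fun n =>
    (measurable_pi_apply n).comp measurable_fst
  have hm : ∀ n, Measurable fun y : (ℕ → Plane) × (ℕ → Mark) => y.2 n := fun n =>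
    (measurable_pi_apply n).comp measurable_snd
  have hcl : ∀ i, MeasurableSet {y : (ℕ → Plane) × (ℕ → Mark) | IsClosest y.1 Set.univ z i} :=
    fun i => measurableSet_isClosest hx (fun _ => MeasurableSet.univ) z i
  have hA : MeasurableSet {y : (ℕ → Plane) × (ℕ → Mark) | ∃ i, IsClosest y.1 Set.univ z i ∧
      (y.2 i).1 = g ∧ ∃ j, Covered α T y.1 y.2 f j} := by
    simp only [Set.ofPred_exists]
    refine MeasurableSet.iUnion fun i => (hcl i).inter (MeasurableSet.inter ?_ ?_)
    · exact (hm i).fst (show MeasurableSet {g} from trivial)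
    · exact measurableSet_exists_covered α T hx hm f
  have hB : MeasurableSet {y : (ℕ → Plane) × (ℕ → Mark) | ∃ i, IsClosest y.1 Set.univ z i ∧
      ∃ j, CoveredExcept α T y.1 y.2 f i j} := by
    simp only [Set.ofPred_exists]
    exact MeasurableSet.iUnion fun i => (hcl i).inter
      (measurableSet_exists_coveredExcept α T hx hm f i)
  refine (hnet.measure_eq_lintegral hA).trans (Eq.trans ?_
    (congrArg (ENNReal.ofReal (portionProb p g) * ·) (hnet.measure_eq_lintegral hB).symm))
  rw [← lintegral_const_mul' _ _ ENNReal.ofReal_ne_top]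
  refine lintegral_congr_ae ?_
  filter_upwards [hnet.ae_dist_injective hlam z, hnet.ae_exists_isClosest hlam] with ω hinj hex
  obtain ⟨i, hi⟩ := hex z
  have huniq : ∀ k, IsClosest (fun n => X n ω) Set.univ z k → k = i := fun k hk =>
    hinj (le_antisymm (hk.2 i trivial) (hi.2 k trivial))
  set B : Set (ℕ → Mark) := {m | ∃ j, CoveredExcept α T (fun n => X n ω) m f i j}
  have hBm : MeasurableSet B := measurableSet_exists_coveredExcept α T
    (x := fun _ n => X n ω) (fun n => measurable_const)
    (m := fun m => m) (fun n => measurable_pi_apply n) f i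
  -- Once `i` is known to cache g ≠ f, it is no candidate for `f`, so striking it out is free; the
  -- remaining event `B` ignores its portion.
  have h1 : {m : ℕ → Mark | ∃ i, IsClosest (fun n => X n ω) Set.univ z i ∧ (m i).1 = g ∧
      ∃ j, Covered α T (fun n => X n ω) m f j} =
      {m | (m i).1 = g ∧ m ∈ B} := by
    ext m
    constructor
    · rintro ⟨k, hk, hkg, j, hj⟩
      obtain rfl := huniq k hk
      exact ⟨hkg, j, (coveredExcept_iff_covered (hkg ▸ hfg)).2 hj⟩
    · rintro ⟨hkg, j, hj⟩
      exact ⟨i, hi, hkg, j, (coveredExcept_iff_covered (hkg ▸ hfg)).1 hj⟩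
  have h2 : {m : ℕ → Mark | ∃ i, IsClosest (fun n => X n ω) Set.univ z i ∧
      ∃ j, CoveredExcept α T (fun n => X n ω) m f i j} = B := by
    ext m
    constructor
    · rintro ⟨k, hk, hj⟩
      obtain rfl := huniq k hk
      exact hj
    · intro hj
      exact ⟨i, hi, hj⟩
  refine (congrArg (marksLaw p q) h1).trans (Eq.trans ?_
    (congrArg (ENNReal.ofReal (portionProb p g) * marksLaw p q ·) h2.symm))
  exact marksLaw_portion_inter i g hBm fun m f₁ f₂ c ⟨j, hj⟩ => ⟨j, coveredExcept_update hj⟩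

/-- Almost surely the indicators agree for large v: some device lies to the left of the closest one
that caches `f`, so that one is eventually not the closest to location 1. -/
lemma IsNetwork.tendsto_measure_coveredExcept (f : FilePortion) :
    Tendsto (fun v => μ {ω | ∃ i, IsClosest (fun n => X n ω) Set.univ (location1 v) i ∧
        ∃ j, CoveredExcept α T (fun n => X n ω) (marks file fading active ω) f i j}) atTop
      (𝓝 (μ {ω | ∃ j, Covered α T (fun n => X n ω) (marks file fading active ω) f j})) := by
  have hx := hnet.measurable_location
  have hm : ∀ n, Measurable fun ω => marks file fading active ω n := fun n =>
    (measurable_pi_apply n).comp hnet.measurable_marks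
  refine tendsto_measure_of_ae_tendsto_indicator_of_isFiniteMeasure atTop ?_ (fun v => ?_) ?_
  · exact measurableSet_exists_covered α T hx hm f
  · simp only [Set.ofPred_exists]
    exact MeasurableSet.iUnion fun i => (hnet.measurableSet_closest_univ _ i).inter
      (measurableSet_exists_coveredExcept α T hx hm f i)
  · filter_upwards [hnet.ae_dist_injective hlam 0, hnet.ae_exists_isClosest hlam,
      hnet.ae_exists_lt hlam] with ω hinj hex hlt
    set x := fun n => X n ω
    set m := marks file fading active ω
    have hev : ∀ᶠ v in atTop, ∀ i, IsClosest x Set.univ (location1 v) i →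
        ¬ IsClosest x {n | (m n).1 = f} 0 i := by
      by_cases hj : ∃ j, IsClosest x {n | (m n).1 = f} 0 j
      · obtain ⟨j, hj⟩ := hj
        obtain ⟨n, hn⟩ := hlt (X j ω 0)
        filter_upwards [eventually_dist_location1_lt hn] with v hv i hi hi'
        have hij : i = j := hinj (le_antisymm (hi'.2 j hj.1) (hj.2 i hi'.1))
        subst hij
        exact absurd (hi.2 n trivial) (not_le.2 hv)
      · exact .of_forall fun v i _ hi => hj ⟨i, hi⟩
    filter_upwards [hev] with v hv
    constructor
    · rintro ⟨i, hi, hc⟩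
      exact (exists_coveredExcept_iff (hv i hi)).1 hc
    · intro hc
      obtain ⟨i, hi⟩ := hex (location1 v)
      exact ⟨i, hi, (exists_coveredExcept_iff (hv i hi)).2 hc⟩

/-- The cases are the two possible portions of file 1; they overlap only when two devices tie as
closest to location 1, a null event. -/
lemma IsNetwork.coverageFile2_eq (v : ℝ) :
    coverageFile2 μ X file fading active α T v =
      (μ {ω | ∃ i, IsClosest (fun n => X n ω) Set.univ (location1 v) i ∧ file i ω = .A ∧
        ∃ j, Covered α T (fun n => X n ω) (marks file fading active ω) .B j}).toReal +
      (μ {ω | ∃ i, IsClosest (fun n => X n ω) Set.univ (location1 v) i ∧ file i ω = .B ∧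
        ∃ j, Covered α T (fun n => X n ω) (marks file fading active ω) .A j}).toReal := by
  set C : FilePortion → FilePortion → Set Ω := fun g f =>
    {ω | ∃ i, IsClosest (fun n => X n ω) Set.univ (location1 v) i ∧ file i ω = g ∧
      ∃ j, Covered α T (fun n => X n ω) (marks file fading active ω) f j}
  have hm : ∀ n, Measurable fun ω => marks file fading active ω n := fun n =>
    (measurable_pi_apply n).comp hnet.measurable_marks
  have hC : ∀ g f, MeasurableSet (C g f) := fun g f => by
    simp only [C, Set.ofPred_exists]
    refine MeasurableSet.iUnion fun i => (hnet.measurableSet_closest_univ _ i).inter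
      (MeasurableSet.inter ?_ ?_)
    · exact hnet.measurable_file i (show MeasurableSet {g} from trivial)
    · exact measurableSet_exists_covered α T hnet.measurable_location hm f
  have hd : AEDisjoint μ (C .A .B) (C .B .A) := by
    have : ∀ᵐ ω ∂μ, ω ∉ C .A .B ∩ C .B .A := by
      filter_upwards [hnet.ae_dist_injective hlam (location1 v)] with ω hinj
      rintro ⟨⟨i, hi, hiA, -⟩, k, hk, hkB, -⟩
      have hik : i = k := hinj (le_antisymm (hi.2 k trivial) (hk.2 i trivial))
      rw [hik, hkB] at hiA
      cases hiA
    simpa [AEDisjoint, ae_iff] using this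
  have hU : {ω | ∃ i j, IsClosest (fun n => X n ω) Set.univ (location1 v) i ∧
      IsClosest (fun n => X n ω) {n | file n ω ≠ file i ω} 0 j ∧
      ENNReal.ofReal T < SIR α (fun n => X n ω) (fun n => fading n ω) (fun n => active n ω) j} =
      C .A .B ∪ C .B .A := by
    ext ω
    have hset : ∀ i, {n | file n ω ≠ file i ω} = {n | file n ω = (file i ω).other} := fun i => by
      ext n
      exact FilePortion.ne_iff_eq_other
    constructor
    · rintro ⟨i, j, hi, hj, hs⟩
      rw [hset] at hj
      rcases (file i ω).eq_A_or_eq_B with h | h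
      · rw [h] at hj
        exact Or.inl ⟨i, hi, h, j, hj, hs⟩
      · rw [h] at hj
        exact Or.inr ⟨i, hi, h, j, hj, hs⟩
    · rintro (⟨i, hi, h, j, hj, hs⟩ | ⟨i, hi, h, j, hj, hs⟩)
      · refine ⟨i, j, hi, ?_, hs⟩
        rw [hset, h]
        exact hj
      · refine ⟨i, j, hi, ?_, hs⟩
        rw [hset, h]
        exact hj
  rw [coverageFile2, hU, measureReal_def, measure_union₀ (hC _ _).nullMeasurableSet hd,
    ENNReal.toReal_add (measure_ne_top _ _) (measure_ne_top _ _)]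

lemma IsNetwork.tendsto_measure_closest_covered (hT : 0 < T) (hα : 2 < α) {f g : FilePortion}
    (hfg : g ≠ f) (hf : 0 < portionProb p f) :
    Tendsto (fun v => (μ {ω | ∃ i, IsClosest (fun n => X n ω) Set.univ (location1 v) i ∧
      file i ω = g ∧ ∃ j, Covered α T (fun n => X n ω) (marks file fading active ω) f j}).toReal)
      atTop (𝓝 (portionProb p g * Pc T α q (portionProb p f))) := by
  simp_rw [hnet.measure_closest_covered hlam _ hfg, ENNReal.toReal_mul,
    ENNReal.toReal_ofReal (portionProb_nonneg p g)]
  rw [← hnet.coverageIndep_eq hlam hT hα f hf]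
  exact ((ENNReal.tendsto_toReal (measure_ne_top _ _)).comp
    (hnet.tendsto_measure_coveredExcept hlam f)).const_mul _

end Network

end D2DCaching

theorem mainTheorem2 {Ω : Type*} [MeasurableSpace Ω] (μ : Measure Ω) [IsProbabilityMeasure μ]
    (lam : ℝ) (hlam : 0 < lam) (p q : unitInterval) (hp0 : 0 < p) (hp1 : p < 1)
    (α : ℝ) (hα : 2 < α) (T : ℝ) (hT : 0 < T)
    (X : ℕ → Ω → D2DCaching.Plane) (file : ℕ → Ω → D2DCaching.FilePortion)
    (fading : ℕ → Ω → ℝ) (active : ℕ → Ω → Bool)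
    (hnet : D2DCaching.IsNetwork μ lam p q X file fading active) :
    Tendsto (fun v : ℝ => D2DCaching.coverageFile2 μ X file fading active α T v) atTop
      (𝓝 ((p : ℝ) * D2DCaching.Pc T α q (1 - (p : ℝ)) +
        (1 - (p : ℝ)) * D2DCaching.Pc T α q p)) ∧
    D2DCaching.coverageIndep μ X file fading active α T D2DCaching.FilePortion.A =
      D2DCaching.Pc T α q p ∧
    D2DCaching.coverageIndep μ X file fading active α T D2DCaching.FilePortion.B =
      D2DCaching.Pc T α q (1 - (p : ℝ)) := by
  have hA : 0 < D2DCaching.portionProb p .A := hp0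
  have hB : 0 < D2DCaching.portionProb p .B := sub_pos.2 hp1
  refine ⟨?_, hnet.coverageIndep_eq hlam hT hα .A hA, hnet.coverageIndep_eq hlam hT hα .B hB⟩
  simp_rw [hnet.coverageFile2_eq hlam]
  exact (hnet.tendsto_measure_closest_covered hlam hT hα (by simp) hB).add
    (hnet.tendsto_measure_closest_covered hlam hT hα (by simp) hA)
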